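/- Consider the fading channel $y=\sqrt{snr}\,h\,x+n$, where $x,h,n$ are independent complex random variables, $n\sim\mathcal{CN}(0,1)$, and the input $x$ is discrete with finite support $\{x_1,\ldots,x_m\}$ (distinct points, $m\ge 1$), taken with probabilities $p_1,\ldots,p_m>0$. Let $H(x)=-\sum_i p_i\log p_i$ be the entropy of the input (natural logarithm). Let $I_{h_0}(snr)$ be the conditional mutual information (in nats) between $x$ and $y$ given $h=h_0$, and let $\overline{I}(snr)=E_h\{I_h(snr)\}$. Let $mmse(t)=E\,|x-E[x\mid \sqrt{t}\,x+n]|^2$ be the canonical MMSE and $M[mmse;s]=\int_0^{\infty}t^{s-1}mmse(t)\,dt$ its Mellin transform. For gauge functions $\varphi_k$ with $\varphi_{k+1}=o(\varphi_k)$, write $f\sim\sum_{k\ge0}a_k\varphi_k$ if $f-\sum_{k=0}^{N}a_k\varphi_k=O(\varphi_{N+1})$ for every $N\ge 0$. (1) Rayleigh and Ricean fading. Let $\sigma>0$ and $\mu\in\mathbb{C}$, and suppose that $h\sim\mathcal{CN}(\mu,2\sigma^2)$ (Rayleigh if $\mu=0$, Ricean if $\mu\ne0$), or, more generally, that $|h|$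 has the density $f_{|h|}(r)=\frac{r}{\sigma^2}\exp\left(-\frac{r^2+|\mu|^2}{2\sigma^2}\right)I_0\left(\frac{r|\mu|}{\sigma^2}\right)$, $r>0$, with $I_0$ the modified Bessel function of the first kind of order zero. Then the integrals $M[mmse;2+k]$, $k\ge 0$, converge and, as $snr\to+\infty$, $$H(x)-\overline{I}(snr)\sim\frac{\exp\left(-\frac{|\mu|^2}{2\sigma^2}\right)}{snr}\sum_{k=0}^{\infty}\left(\sum_{j=0}^{k}\frac{(-1)^{k-j}}{(k+1)\,(k-j)!\,(2\sigma^2)^{k+j+1}}\,\frac{|\mu|^{2j}}{(j!)^2}\right)M[mmse;2+k]\,\frac{1}{snr^{k}}.$$ (2) Nakagami fading. Let $\mu\ge\frac12$ and $w>0$, and suppose that $|h|$ has the density $f_{|h|}(r)=\frac{2\mu^{\mu}}{\Gamma(\mu)w^{\mu}}r^{2\mu-1}\exp\left(-\frac{\mu}{w}r^2\right)$, $r>0$. Then the integrals $M[mmse;1+\mu+k]$, $k\ge0$, converge and, as $snr\to+\infty$, $$H(x)-\overline{I}(snr)\sim\frac{\mu^{\mu}}{snr^{\mu}\,\Gamma(\mu)\,w^{\mu}}\sum_{k=0}^{\infty}\frac{(-1)^k\mu^k}{(\mu+k)\,k!\,w^k}\,M[mmse;1+\mu+k]\,\frac{1}{snr^{k}}.$$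 In particular, if the input is equiprobable ($p_i=1/m$ for all $i$), then both expansions hold for $\log m-\overline{I}(snr)$. -/

import Mathlib

open MeasureTheory ProbabilityTheory Filter Asymptotics

noncomputable section

namespace FadingChannel

/-- The Poincaré-type asymptotic expansion `f(t) ∼ ∑ₙ aₙ φₙ(t)` as `t → +∞`: the gauge functions
are continuous on the positive half-line, each is negligible with respect to the previous one, and
truncating the formal series after the `N`-th term leaves an error `O(φ_{N+1})`, for every `N`. -/
def HasAsymptoticExpansion (f : ℝ → ℂ) (a : ℕ → ℂ) (φ : ℕ → ℝ → ℝ) : Prop :=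
  (∀ k, ContinuousOn (φ k) (Set.Ioi 0)) ∧
  (∀ k, φ (k + 1) =o[atTop] φ k) ∧
  ∀ N : ℕ, (fun t => f t - ∑ k ∈ Finset.range (N + 1), a k * (φ k t : ℂ)) =O[atTop] φ (N + 1)

/-- The law `𝒞𝒩(ν, v)`: independent Gaussian real and imaginary parts, of means `Re ν` and `Im ν`
and of variance `v / 2` each. -/
def complexGaussian (ν : ℂ) (v : NNReal) : Measure ℂ :=
  ((gaussianReal ν.re (v / 2)).prod (gaussianReal ν.im (v / 2))).map
    (fun p : ℝ × ℝ => (p.1 : ℂ) + (p.2 : ℂ) * Complex.I)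

/-- The modified Bessel function of the first kind of order zero, on the real line. -/
def besselI0 (z : ℝ) : ℝ := ∑' k : ℕ, (z ^ 2 / 4) ^ k / ((k.factorial : ℝ) ^ 2)

/-- The Rayleigh density (on `r > 0`). -/
def rayleighDensity (σ r : ℝ) : ℝ := r / σ ^ 2 * Real.exp (-(r ^ 2 / (2 * σ ^ 2)))

/-- The density (on `r > 0`) of the Rice distribution with parameters `ρ` and `σ`. -/
def riceDensity (ρ σ r : ℝ) : ℝ :=
  r / σ ^ 2 * Real.exp (-((r ^ 2 + ρ ^ 2) / (2 * σ ^ 2))) * besselI0 (r * ρ / σ ^ 2)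

/-- The density (on `r > 0`) of the Nakagami distribution with parameters `μ` and `w`. -/
def nakagamiDensity (μ w r : ℝ) : ℝ :=
  2 * μ ^ μ / (Real.Gamma μ * w ^ μ) * r ^ (2 * μ - 1) * Real.exp (-(μ / w * r ^ 2))

section Model

variable {Ω : Type*} [MeasurableSpace Ω]

/-- The modulus `|h|` has density `f` on the positive half-line. -/
def ModulusHasDensity (P : Measure Ω) (h : Ω → ℂ) (f : ℝ → ℝ) : Prop :=
  P.map (fun ω => ‖h ω‖) =
    (volume.restrict (Set.Ioi 0)).withDensity (fun r => ENNReal.ofReal (f r))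

/-- Rayleigh (`ν = 0`) or Ricean (`ν ≠ 0`) fading: the gain is `𝒞𝒩(ν, 2σ²)`, or, more generally,
its modulus has the corresponding Rayleigh or Rice density. -/
def IsRayleighOrRiceFading (P : Measure Ω) (h : Ω → ℂ) (ν : ℂ) (σ : ℝ) : Prop :=
  P.map h = complexGaussian ν (Real.toNNReal (2 * σ ^ 2)) ∨
  (ν = 0 ∧ ModulusHasDensity P h (rayleighDensity σ)) ∨
  (ν ≠ 0 ∧ ModulusHasDensity P h (riceDensity ‖ν‖ σ))

/-- `x` is a discrete random variable with finite support `S`. -/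
def HasFiniteSupport (P : Measure Ω) (x : Ω → ℂ) (S : Finset ℂ) : Prop :=
  (∀ᵐ ω ∂P, x ω ∈ S) ∧ ∀ a ∈ S, 0 < P.real (x ⁻¹' {a})

/-- The input takes each value of its support with the same probability. -/
def IsEquiprobable (P : Measure Ω) (x : Ω → ℂ) (S : Finset ℂ) : Prop :=
  ∀ a ∈ S, P.real (x ⁻¹' {a}) = 1 / (S.card : ℝ)

/-- The entropy, in nats, of a discrete random variable with finite support `S`. -/
def entropy (P : Measure Ω) (x : Ω → ℂ) (S : Finset ℂ) : ℝ :=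
  -∑ a ∈ S, P.real (x ⁻¹' {a}) * Real.log (P.real (x ⁻¹' {a}))

/-- The output `√snr x + n` of the canonical channel. -/
def canonicalOutput (x n : Ω → ℂ) (snr : ℝ) (ω : Ω) : ℂ :=
  (Real.sqrt snr : ℂ) * x ω + n ω

/-- The output `√snr h x + n` of the fading channel. -/
def output (x h n : Ω → ℂ) (snr : ℝ) (ω : Ω) : ℂ :=
  (Real.sqrt snr : ℂ) * h ω * x ω + n ω

/-- The canonical MMSE, `E |x - E[x | y]|²` with `y = √snr x + n`. -/
def mmse (P : Measure Ω) (x n : Ω → ℂ) (snr : ℝ) : ℝ :=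
  ∫ ω, ‖x ω - (P[x | MeasurableSpace.comap (canonicalOutput x n snr) inferInstance]) ω‖ ^ 2 ∂P

/-- The mutual information of the two coordinates under a joint law `ρ` with marginals `α`, `β`:
the expectation under `ρ` of the logarithm of the density of `ρ` with respect to `α ⊗ β`. -/
def mutualInfoOfLaws (ρ : Measure (ℂ × ℂ)) (α β : Measure ℂ) : ℝ :=
  ∫ z, llr ρ (α.prod β) z ∂ρ

/-- The conditional mutual information between the input and the output of the fading channel
given `h = h₀`, computed from the regular conditional laws of `(x, y)`, `x` and `y` given `h`. -/
def condMutualInfo (P : Measure Ω) [IsFiniteMeasure P] (x h n : Ω → ℂ) (snr : ℝ) (h₀ : ℂ) : ℝ :=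
  mutualInfoOfLaws (condDistrib (fun ω => (x ω, output x h n snr ω)) h P h₀)
    (condDistrib x h P h₀) (condDistrib (output x h n snr) h P h₀)

/-- The average mutual information `E_h {I_h(snr)}`. -/
def avgMutualInfo (P : Measure Ω) [IsFiniteMeasure P] (x h n : Ω → ℂ) (snr : ℝ) : ℝ :=
  ∫ h₀, condMutualInfo P x h n snr h₀ ∂(P.map h)

/-- The canonical MMSE as a complex-valued function, whose Mellin transform
`M[mmse; s] = ∫₀^∞ t^(s-1) mmse(t) dt` is `mellin (mmseC P x n) s`. -/
def mmseC (P : Measure Ω) (x n : Ω → ℂ) (t : ℝ) : ℂ := (mmse P x n t : ℂ)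

end Model

/-- The coefficient of `snr^(-1-k)` for Rayleigh and Ricean fading. -/
def riceCoeff (M : ℂ → ℂ) (ν : ℂ) (σ : ℝ) (k : ℕ) : ℂ :=
  (Real.exp (-(‖ν‖ ^ 2 / (2 * σ ^ 2))) *
    ∑ j ∈ Finset.range (k + 1),
      (-1 : ℝ) ^ (k - j) /
        ((k + 1) * ((k - j).factorial : ℝ) * (2 * σ ^ 2) ^ (k + j + 1)) *
        (‖ν‖ ^ (2 * j) / (j.factorial : ℝ) ^ 2) : ℝ) * M (2 + k)

/-- The coefficient of `snr^(-μ-k)` for Nakagami fading. -/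
def nakagamiCoeff (M : ℂ → ℂ) (μ w : ℝ) (k : ℕ) : ℂ :=
  (μ ^ μ / (Real.Gamma μ * w ^ μ) *
    ((-1 : ℝ) ^ k * μ ^ k / ((μ + k) * (k.factorial : ℝ) * w ^ k)) : ℝ) * M (1 + μ + k)

end FadingChannel

end

/-! At a fixed gain `a`, the mutual information is the input entropy minus the equivocation H(x | a
x + n). The noise is circularly symmetric, so the equivocation depends on `a` only through its
modulus. Averaging over the gain therefore gives H(x) - Ī(snr) = E g(snr |h|²), where g(t) = H(x |
√t x + n) is `informationGap`. Only the law of |h| matters, and the problem becomes the asymptotics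
of a scaled average of one fixed function g.

Two facts about g suffice. First, g and mmse decay exponentially (`exists_mul_exp_bound`): the
posterior mass of a wrong point is at most the square root of a likelihood ratio, and the Gaussian
mean of that root is the Bhattacharyya overlap exp(-|a (i - j)|² / 4). Second, g' = -mmse on t > 0
(`hasDerivAt_equivocation`): differentiate the mean log-likelihood of a Gaussian mixture under the
integral, then remove the term linear in the noise by Gaussian integration by parts.

Suppose now that |h|² has density v^(α-1) q(v) with q = ∑ a_k v^k entire and bounded on v > 0. A
Taylor polynomial of q then has an error at most C v^N on the whole half-line, and the scaling v ↦ v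
/ snr turns each monomial into a_k snr^(-(α+k)) ∫ v^(α+k-1) g (`isBigO_integral_sub_sum`).
Integration by parts with g' = -mmse rewrites this moment as M[mmse; 1+α+k] / (α+k), which is where
the denominators in the coefficients come from (`mellin_mmseC`).

Rice fading is the case α = 1, with q a Bessel series times an exponential, whose Cauchy product
gives the inner sum over j. Nakagami fading is the case α = μ, with q a pure exponential. A Gaussian
gain reduces to Rice by polar coordinates. -/

namespace FadingChannel

/-! ### The standard complex Gaussian kernel -/

noncomputable section

/-- The density of the standard complex Gaussian law. -/
def gaussKernel (z : ℂ) : ℝ := Real.exp (-‖z‖ ^ 2) / Real.pi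

lemma gaussKernel_pos (z : ℂ) : 0 < gaussKernel z := by
  unfold gaussKernel; positivity

lemma continuous_gaussKernel : Continuous gaussKernel := by
  unfold gaussKernel; fun_prop

lemma integral_exp_neg_mul_sq_norm_complex {b : ℝ} (hb : 0 < b) :
    ∫ z : ℂ, Real.exp (-b * ‖z‖ ^ 2) = Real.pi / b := by
  rw [GaussianFourier.integral_rexp_neg_mul_sq_norm hb]
  simp

lemma integrable_exp_neg_mul_sq_norm_complex {b : ℝ} (hb : 0 < b) :
    Integrable (fun z : ℂ => Real.exp (-b * ‖z‖ ^ 2)) := by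
  apply Integrable.of_integral_ne_zero
  rw [integral_exp_neg_mul_sq_norm_complex hb]
  positivity

lemma integral_gaussKernel : ∫ z, gaussKernel z = 1 := by
  unfold gaussKernel
  rw [integral_div]
  have := integral_exp_neg_mul_sq_norm_complex one_pos
  simp only [neg_mul, one_mul, div_one] at this
  rw [this, div_self Real.pi_ne_zero]

lemma integrable_gaussKernel : Integrable gaussKernel := by
  apply Integrable.of_integral_ne_zero
  rw [integral_gaussKernel]
  exact one_ne_zero

lemma integrable_gaussKernel_mul_sq_norm : Integrable (fun z => gaussKernel z * ‖z‖ ^ 2) := by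
  have h := integrable_exp_neg_mul_sq_norm_complex (b := 1 / 2) (by norm_num)
  refine (h.const_mul 2).mono' (by unfold gaussKernel; fun_prop) (ae_of_all _ fun z => ?_)
  rw [Real.norm_of_nonneg (mul_nonneg (gaussKernel_pos z).le (sq_nonneg _)), gaussKernel]
  have h1 : Real.exp (-‖z‖ ^ 2) = Real.exp (-(1 / 2) * ‖z‖ ^ 2) * Real.exp (-(1 / 2 * ‖z‖ ^ 2)) := by
    rw [← Real.exp_add]; ring_nf
  have h2 : 1 / 2 * ‖z‖ ^ 2 * Real.exp (-(1 / 2 * ‖z‖ ^ 2)) ≤ 1 :=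
    (Real.mul_exp_neg_le_exp_neg_one _).trans (Real.exp_le_one_iff.2 (by norm_num))
  have h3 : Real.exp (-‖z‖ ^ 2) / Real.pi ≤ Real.exp (-‖z‖ ^ 2) :=
    div_le_self (Real.exp_pos _).le (by linarith [Real.pi_gt_three])
  calc Real.exp (-‖z‖ ^ 2) / Real.pi * ‖z‖ ^ 2 ≤ Real.exp (-‖z‖ ^ 2) * ‖z‖ ^ 2 := by gcongr
    _ = 2 * Real.exp (-(1 / 2) * ‖z‖ ^ 2) * (1 / 2 * ‖z‖ ^ 2 * Real.exp (-(1 / 2 * ‖z‖ ^ 2))) := by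
      rw [h1]; ring
    _ ≤ 2 * Real.exp (-(1 / 2) * ‖z‖ ^ 2) := mul_le_of_le_one_right (by positivity) h2

/-- The common integrability criterion below: log-likelihoods and their derivatives grow at most
quadratically in the noise. -/
lemma integrable_gaussKernel_mul_of_le {f : ℂ → ℝ} (hf : AEStronglyMeasurable f) {A B : ℝ}
    (h : ∀ z, |f z| ≤ A + B * ‖z‖ ^ 2) : Integrable (fun z => gaussKernel z * f z) := by
  refine ((integrable_gaussKernel.mul_const A).add
    (integrable_gaussKernel_mul_sq_norm.mul_const B)).mono'
    (continuous_gaussKernel.aestronglyMeasurable.mul hf) (ae_of_all _ fun z => ?_)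
  rw [norm_mul, Real.norm_of_nonneg (gaussKernel_pos z).le, Real.norm_eq_abs]
  calc gaussKernel z * |f z| ≤ gaussKernel z * (A + B * ‖z‖ ^ 2) :=
        mul_le_mul_of_nonneg_left (h z) (gaussKernel_pos z).le
    _ = _ := by simp only [Pi.add_apply]; ring

lemma hasLineDerivAt_gaussKernel (z v : ℂ) :
    HasLineDerivAt ℝ gaussKernel (gaussKernel z * (-2 * inner ℝ z v)) z v := by
  have h : HasDerivAt (fun t : ℝ => z + t • v) v 0 := by
    simpa using ((hasDerivAt_id (0 : ℝ)).smul_const v).const_add z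
  have := (h.norm_sq.fun_neg.exp).div_const Real.pi
  refine HasDerivAt.congr_deriv this ?_
  simp only [gaussKernel, zero_smul, add_zero]; ring

/-! ### Gaussian mixtures: derivative of the mean log-likelihood -/

section Mixture

variable (p : ℂ → ℝ) (J : Finset ℂ) (d : ℂ → ℂ)

/-- The Gaussian mixture with weights `p j` and centres `-a d j`, up to normalization. -/
def partition (a z : ℂ) : ℝ := ∑ j ∈ J, p j * Real.exp (-‖z + a * d j‖ ^ 2)

/-- The posterior probability of the `j`-th component of a Gaussian mixture. -/
def posterior (a : ℂ) (j z : ℂ) : ℝ := p j * Real.exp (-‖z + a * d j‖ ^ 2) / partition p J d a z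

variable {p J d}

lemma partition_pos (hp : ∀ j ∈ J, 0 < p j) (hJ : J.Nonempty) (a z : ℂ) :
    0 < partition p J d a z :=
  Finset.sum_pos (fun j hj => mul_pos (hp j hj) (Real.exp_pos _)) hJ

lemma continuous_partition (a : ℂ) : Continuous (partition p J d a) := by
  unfold partition; fun_prop

lemma posterior_nonneg (hp : ∀ j ∈ J, 0 < p j) (a : ℂ) {j : ℂ} (hj : j ∈ J) (z : ℂ) :
    0 ≤ posterior p J d a j z :=
  div_nonneg (mul_pos (hp j hj) (Real.exp_pos _)).le (partition_pos hp ⟨j, hj⟩ a z).le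

lemma sum_posterior (hp : ∀ j ∈ J, 0 < p j) (hJ : J.Nonempty) (a z : ℂ) :
    ∑ j ∈ J, posterior p J d a j z = 1 := by
  unfold posterior
  rw [← Finset.sum_div]
  exact div_self (partition_pos hp hJ a z).ne'

lemma posterior_le_one (hp : ∀ j ∈ J, 0 < p j) (a : ℂ) {j : ℂ} (hj : j ∈ J) (z : ℂ) :
    posterior p J d a j z ≤ 1 := by
  rw [← sum_posterior (d := d) hp ⟨j, hj⟩ a z]
  exact Finset.single_le_sum (f := fun j => posterior p J d a j z)
    (fun i hi => posterior_nonneg hp a hi z) hj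

lemma continuous_posterior (hp : ∀ j ∈ J, 0 < p j) (hJ : J.Nonempty) (a j : ℂ) :
    Continuous (posterior p J d a j) := by
  unfold posterior
  exact Continuous.div (by fun_prop) (continuous_partition a)
    (fun z => (partition_pos hp hJ a z).ne')

lemma abs_sum_posterior_mul_le (hp : ∀ j ∈ J, 0 < p j) (hJ : J.Nonempty) (a z : ℂ) {f : ℂ → ℝ}
    {C : ℝ} (hf : ∀ j ∈ J, |f j| ≤ C) : |∑ j ∈ J, posterior p J d a j z * f j| ≤ C := by
  calc |∑ j ∈ J, posterior p J d a j z * f j| ≤ ∑ j ∈ J, posterior p J d a j z * C := by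
        refine (Finset.abs_sum_le_sum_abs _ _).trans (Finset.sum_le_sum fun j hj => ?_)
        rw [abs_mul, abs_of_nonneg (posterior_nonneg hp a hj z)]
        exact mul_le_mul_of_nonneg_left (hf j hj) (posterior_nonneg hp a hj z)
    _ = C := by rw [← Finset.sum_mul, sum_posterior hp hJ, one_mul]

lemma hasDerivAt_partition (z : ℂ) (s : ℝ) :
    HasDerivAt (fun s : ℝ => partition p J d s z)
      (∑ j ∈ J, p j * Real.exp (-‖z + s * d j‖ ^ 2) * (-2 * inner ℝ (z + s * d j) (d j))) s := by
  unfold partition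
  refine HasDerivAt.fun_sum fun j _ => ?_
  have h : HasDerivAt (fun t : ℝ => z + t * d j) (d j) s := by
    simpa using ((hasDerivAt_id s).ofReal_comp.mul_const (d j)).const_add z
  exact ((h.norm_sq.fun_neg.exp).const_mul (p j)).congr_deriv (by ring)

lemma hasDerivAt_log_partition (hp : ∀ j ∈ J, 0 < p j) (hJ : J.Nonempty) (z : ℂ) (s : ℝ) :
    HasDerivAt (fun s : ℝ => Real.log (partition p J d s z))
      (∑ j ∈ J, posterior p J d s j z * (-2 * inner ℝ (z + s * d j) (d j))) s := by
  convert (hasDerivAt_partition z s).log (partition_pos hp hJ _ z).ne' using 1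
  rw [Finset.sum_div]
  refine Finset.sum_congr rfl fun j _ => ?_
  unfold posterior; ring

lemma hasLineDerivAt_weight (a z v j : ℂ) :
    HasLineDerivAt ℝ (fun z => p j * Real.exp (-‖z + a * d j‖ ^ 2))
      (p j * Real.exp (-‖z + a * d j‖ ^ 2) * (-2 * inner ℝ (z + a * d j) v)) z v := by
  have h : HasDerivAt (fun t : ℝ => z + t • v + a * d j) v 0 := by
    simpa using (((hasDerivAt_id (0 : ℝ)).smul_const v).const_add z).add_const (a * d j)
  refine HasDerivAt.congr_deriv ((h.norm_sq.fun_neg.exp).const_mul (p j)) ?_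
  simp only [zero_smul, add_zero]; ring

/-- Each weight has logarithmic derivative -2⟨z + s d_j, v⟩. The common part -2⟨z, v⟩ cancels in the
quotient, leaving only differences of centres, so this derivative is bounded in z. -/
lemma hasLineDerivAt_posterior (hp : ∀ j ∈ J, 0 < p j) (hJ : J.Nonempty) (s : ℝ) (z v j : ℂ) :
    HasLineDerivAt ℝ (posterior p J d s j)
      (posterior p J d s j z * (2 * s *
        (∑ k ∈ J, posterior p J d s k z * inner ℝ (d k) v - inner ℝ (d j) v))) z v := by
  have h1 := hasLineDerivAt_weight (p := p) (d := d) s z v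
  have h2 : HasLineDerivAt ℝ (partition p J d s)
      (∑ j ∈ J, p j * Real.exp (-‖z + s * d j‖ ^ 2) * (-2 * inner ℝ (z + s * d j) v)) z v := by
    unfold HasLineDerivAt partition
    exact HasDerivAt.fun_sum fun j _ => h1 j
  have hne := (partition_pos (d := d) hp hJ s z).ne'
  have h3 := HasDerivAt.fun_div (h1 j) h2 (by simpa using hne)
  refine HasDerivAt.congr_deriv h3 ?_
  simp only [zero_smul, add_zero, posterior]
  have h4 : ∀ k, inner ℝ (z + (s : ℂ) * d k) v = inner ℝ z v + s * inner ℝ (d k) v := by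
    intro k
    rw [inner_add_left, ← Complex.real_smul, real_inner_smul_left]
  have h5 : ∑ k ∈ J, p k * Real.exp (-‖z + s * d k‖ ^ 2) * (-2 * inner ℝ (z + s * d k) v)
      = -2 * inner ℝ z v * partition p J d s z
        - 2 * s * ∑ k ∈ J, p k * Real.exp (-‖z + s * d k‖ ^ 2) * inner ℝ (d k) v := by
    unfold partition
    simp only [h4, Finset.mul_sum, ← Finset.sum_sub_distrib]
    exact Finset.sum_congr rfl fun k _ => by ring
  have h6 : ∑ k ∈ J, p k * Real.exp (-‖z + s * d k‖ ^ 2) / partition p J d s z * inner ℝ (d k) v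
      = (∑ k ∈ J, p k * Real.exp (-‖z + s * d k‖ ^ 2) * inner ℝ (d k) v)
        / partition p J d s z := by
    rw [Finset.sum_div]
    exact Finset.sum_congr rfl fun k _ => by ring
  rw [h5, h6, h4]
  field_simp
  ring

lemma abs_posterior_le_one (hp : ∀ j ∈ J, 0 < p j) (a : ℂ) {j : ℂ} (hj : j ∈ J) (z : ℂ) :
    |posterior p J d a j z| ≤ 1 := by
  rw [abs_of_nonneg (posterior_nonneg hp _ hj z)]
  exact posterior_le_one hp _ hj z

lemma integrable_gaussKernel_posterior_inner (hp : ∀ j ∈ J, 0 < p j) (a : ℂ) {j : ℂ} (hj : j ∈ J)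
    (v : ℂ) :
    Integrable fun z => gaussKernel z * (posterior p J d a j z * (-2 * inner ℝ z v)) := by
  have hc := continuous_posterior (d := d) hp ⟨j, hj⟩ a j
  refine integrable_gaussKernel_mul_of_le (A := ‖v‖ ^ 2) (B := 1) (by fun_prop) fun z => ?_
  rw [abs_mul, abs_mul]
  have h1 := abs_real_inner_le_norm z v
  have h2 := sq_nonneg (‖z‖ - ‖v‖)
  have h3 : |posterior p J d a j z| * (|-2| * |inner ℝ z v|) ≤ 1 * (|-2| * |inner ℝ z v|) :=
    mul_le_mul_of_nonneg_right (abs_posterior_le_one hp a hj z) (by positivity)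
  rw [abs_neg, abs_two] at h3 ⊢
  nlinarith

lemma integrable_gaussKernel_posterior_sum (hp : ∀ j ∈ J, 0 < p j) (a : ℂ) {j : ℂ} (hj : j ∈ J)
    (v : ℂ) (b c : ℝ) :
    Integrable fun z => gaussKernel z * (posterior p J d a j z * (b *
        (∑ k ∈ J, posterior p J d a k z * inner ℝ (d k) v - c))) := by
  have hJ : J.Nonempty := ⟨j, hj⟩
  have hc := continuous_posterior (d := d) hp hJ a
  obtain ⟨C, hC⟩ : ∃ C, ∀ k ∈ J, |inner ℝ (d k) v| ≤ C :=
    ⟨∑ k ∈ J, |inner ℝ (d k) v|, fun k hk =>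
      Finset.single_le_sum (f := fun k => |inner ℝ (d k) v|) (fun _ _ => abs_nonneg _) hk⟩
  refine integrable_gaussKernel_mul_of_le (A := |b| * (C + |c|)) (B := 0)
    (by fun_prop) fun z => ?_
  rw [abs_mul, abs_mul]
  have h1 := abs_sum_posterior_mul_le (d := d) hp hJ a z hC
  have h2 : |∑ k ∈ J, posterior p J d a k z * inner ℝ (d k) v - c| ≤ C + |c| :=
    (abs_sub _ _).trans (add_le_add h1 le_rfl)
  have h3 := mul_le_mul_of_nonneg_left h2 (abs_nonneg b)
  have h4 := mul_le_mul (abs_posterior_le_one (d := d) hp a hj z) h3 (by positivity) zero_le_one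
  linarith

/-- Integration by parts against the Gaussian kernel. -/
lemma integral_gaussKernel_posterior_inner (hp : ∀ j ∈ J, 0 < p j) (s : ℝ) {j : ℂ} (hj : j ∈ J)
    (v : ℂ) :
    ∫ z, gaussKernel z * (posterior p J d s j z * (-2 * inner ℝ z v)) =
      -∫ z, gaussKernel z * (posterior p J d s j z * (2 * s *
        (∑ k ∈ J, posterior p J d s k z * inner ℝ (d k) v - inner ℝ (d j) v))) := by
  have hJ : J.Nonempty := ⟨j, hj⟩
  have hc := continuous_posterior (d := d) hp hJ s j
  have I1 := integrable_gaussKernel_posterior_inner (d := d) hp s hj v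
  have I2 := integrable_gaussKernel_posterior_sum (d := d) hp s hj v (2 * s) (inner ℝ (d j) v)
  have I3 : Integrable fun z => gaussKernel z * posterior p J d s j z :=
    integrable_gaussKernel_mul_of_le (A := 1) (B := 0) (by fun_prop)
      fun z => by simpa using abs_posterior_le_one hp s hj z
  have := integral_bilinear_hasLineDerivAt_right_eq_neg_left_of_integrable (μ := volume)
    (f := posterior p J d s j) (g := gaussKernel) (v := v) (B := ContinuousLinearMap.mul ℝ ℝ)
    (f' := fun z => (posterior p J d s j z * (2 * s *
        (∑ k ∈ J, posterior p J d s k z * inner ℝ (d k) v - inner ℝ (d j) v))))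
    (g' := fun z => gaussKernel z * (-2 * inner ℝ z v))
    (by simpa only [ContinuousLinearMap.mul_apply', mul_comm (gaussKernel _)] using I2)
    (I1.congr (ae_of_all _ fun z => by simp only [ContinuousLinearMap.mul_apply']; ring))
    (by simpa only [ContinuousLinearMap.mul_apply', mul_comm (gaussKernel _)] using I3)
    (fun z _ => hasLineDerivAt_posterior hp hJ s z v j) (fun z _ => hasLineDerivAt_gaussKernel z v)
  simp only [ContinuousLinearMap.mul_apply'] at this
  convert this using 1
  · exact integral_congr_ae (ae_of_all _ fun z => by ring)
  · congr 1
    exact integral_congr_ae (ae_of_all _ fun z => by ring)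

lemma integrable_gaussKernel_posterior (hp : ∀ j ∈ J, 0 < p j) (a : ℂ) {j : ℂ} (hj : j ∈ J)
    (c : ℝ) : Integrable fun z => gaussKernel z * (posterior p J d a j z * c) := by
  have hc := continuous_posterior (d := d) hp ⟨j, hj⟩ a j
  refine integrable_gaussKernel_mul_of_le (A := |c|) (B := 0) (by fun_prop) fun z => ?_
  rw [abs_mul, zero_mul, add_zero]
  exact mul_le_of_le_one_left (abs_nonneg c) (abs_posterior_le_one hp a hj z)

/-- This is the form in which the squared norm appears after integration by parts, where v = d_j is
summed against the posterior. -/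
lemma sq_norm_sum_posterior_mul (a z : ℂ) :
    ‖∑ j ∈ J, (posterior p J d a j z : ℂ) * d j‖ ^ 2 =
      ∑ j ∈ J, posterior p J d a j z * ∑ k ∈ J, posterior p J d a k z * inner ℝ (d k) (d j) := by
  rw [← real_inner_self_eq_norm_sq, inner_sum]
  refine Finset.sum_congr rfl fun j _ => ?_
  rw [← Complex.real_smul, real_inner_smul_right, sum_inner]
  congr 1
  refine Finset.sum_congr rfl fun k _ => ?_
  rw [← Complex.real_smul, real_inner_smul_left]

/-- Integrating the ⟨z, d_j⟩ term by parts produces a multiple of ‖d_j‖² that cancels the one coming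
from s d_j. Only the posterior mean of the centres survives. The `- 0` matches the shape of
`integrable_gaussKernel_posterior_sum`. -/
lemma integral_gaussKernel_posterior_inner_add (hp : ∀ j ∈ J, 0 < p j) (s : ℝ) {j : ℂ}
    (hj : j ∈ J) :
    Integrable (fun z =>
      gaussKernel z * (posterior p J d s j z * (-2 * inner ℝ (z + s * d j) (d j)))) ∧
    ∫ z, gaussKernel z * (posterior p J d s j z * (-2 * inner ℝ (z + s * d j) (d j))) =
      ∫ z, gaussKernel z * (posterior p J d s j z * (-2 * s *
        (∑ k ∈ J, posterior p J d s k z * inner ℝ (d k) (d j) - 0))) := by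
  have I1 := integrable_gaussKernel_posterior_inner (d := d) hp s hj (d j)
  have I2 := integrable_gaussKernel_posterior_sum (d := d) hp s hj (d j) (2 * s)
    (inner ℝ (d j) (d j))
  have I3 := integrable_gaussKernel_posterior (d := d) hp s hj (-2 * s * inner ℝ (d j) (d j))
  have h : ∀ z, gaussKernel z * (posterior p J d s j z * (-2 * inner ℝ (z + s * d j) (d j))) =
      gaussKernel z * (posterior p J d s j z * (-2 * inner ℝ z (d j))) +
      gaussKernel z * (posterior p J d s j z * (-2 * s * inner ℝ (d j) (d j))) := by
    intro z
    rw [inner_add_left, ← Complex.real_smul, real_inner_smul_left]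
    ring
  simp only [h]
  refine ⟨I1.add I3, ?_⟩
  rw [integral_add I1 I3, integral_gaussKernel_posterior_inner hp s hj, neg_add_eq_sub,
    ← integral_sub I3 I2]
  exact integral_congr_ae (ae_of_all _ fun z => by ring)

/-- The component centred at the origin alone bounds the mixture from below; dropping all the
exponentials bounds it by the total mass 1. -/
lemma abs_log_partition_le (hp : ∀ j ∈ J, 0 < p j) (hsum : ∑ j ∈ J, p j = 1) {i : ℂ}
    (hi : i ∈ J) (hdi : d i = 0) (a z : ℂ) :
    |Real.log (partition p J d a z)| ≤ |Real.log (p i)| + 1 * ‖z‖ ^ 2 := by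
  have h1 : p i * Real.exp (-‖z‖ ^ 2) ≤ partition p J d a z := by
    have := Finset.single_le_sum (f := fun j => p j * Real.exp (-‖z + a * d j‖ ^ 2))
      (fun j hj => (mul_pos (hp j hj) (Real.exp_pos _)).le) hi
    simpa [hdi, partition] using this
  have h2 : partition p J d a z ≤ 1 := by
    rw [← hsum]
    refine Finset.sum_le_sum fun j hj => mul_le_of_le_one_right (hp j hj).le ?_
    rw [Real.exp_le_one_iff]; nlinarith [sq_nonneg ‖z + a * d j‖]
  have hpos : 0 < p i * Real.exp (-‖z‖ ^ 2) := mul_pos (hp i hi) (Real.exp_pos _)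
  have h3 := Real.log_le_log hpos h1
  have h4 := Real.log_nonpos (hpos.le.trans h1) h2
  rw [Real.log_mul (hp i hi).ne' (Real.exp_pos _).ne', Real.log_exp] at h3
  rw [abs_of_nonpos h4]
  linarith [neg_abs_le (Real.log (p i))]

/-- The derivative of the mean log-likelihood of a Gaussian mixture along a scaling of its
centres. -/
theorem hasDerivAt_integral_log_partition (hp : ∀ j ∈ J, 0 < p j) (hsum : ∑ j ∈ J, p j = 1) {i : ℂ}
    (hi : i ∈ J) (hdi : d i = 0) (s : ℝ) :
    HasDerivAt (fun s : ℝ => ∫ z, gaussKernel z * Real.log (partition p J d s z))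
      (-2 * s * ∫ z, gaussKernel z * ‖∑ j ∈ J, (posterior p J d s j z : ℂ) * d j‖ ^ 2) s := by
  have hJ : J.Nonempty := ⟨i, hi⟩
  have hc := fun (s : ℝ) k => (continuous_posterior (d := d) hp hJ s k)
  have hlog : ∀ s : ℝ, Continuous fun z => Real.log (partition p J d s z) := fun s =>
    (continuous_partition s).log fun z => (partition_pos hp hJ s z).ne'
  obtain ⟨C, hC0, hC⟩ : ∃ C, 0 ≤ C ∧ ∀ k ∈ J, ‖d k‖ ≤ C :=
    ⟨∑ k ∈ J, ‖d k‖, Finset.sum_nonneg fun _ _ => norm_nonneg _, fun k hk =>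
      Finset.single_le_sum (f := fun k => ‖d k‖) (fun _ _ => norm_nonneg _) hk⟩
  -- The domination is uniform for |t - s| < 1, where |t| ≤ |s| + 1. The cross term is absorbed by 2
  -- C ‖z‖ ≤ C² + ‖z‖².
  have key := hasDerivAt_integral_of_dominated_loc_of_deriv_le (μ := (volume : Measure ℂ))
    (F := fun (s : ℝ) z => gaussKernel z * Real.log (partition p J d s z))
    (F' := fun (s : ℝ) z => gaussKernel z *
      ∑ j ∈ J, posterior p J d s j z * (-2 * inner ℝ (z + s * d j) (d j)))
    (bound := fun z => gaussKernel z * ((C ^ 2 + 2 * (|s| + 1) * C ^ 2) + 1 * ‖z‖ ^ 2))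
    (x₀ := s) (Metric.ball_mem_nhds s one_pos)
    (Eventually.of_forall fun s =>
      (continuous_gaussKernel.mul (hlog s)).aestronglyMeasurable)
    (integrable_gaussKernel_mul_of_le (hlog s).aestronglyMeasurable
      (abs_log_partition_le hp hsum hi hdi s))
    (by have := hc s; have := continuous_gaussKernel; fun_prop)
    (ae_of_all _ fun z t ht => ?_)
    (integrable_gaussKernel_mul_of_le (by fun_prop) fun z => by
      rw [abs_of_nonneg (by positivity)])
    (ae_of_all _ fun z t _ => (hasDerivAt_log_partition hp hJ z t).const_mul _)
  · refine HasDerivAt.congr_deriv key.2 ?_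
    simp only [Finset.mul_sum]
    rw [integral_finsetSum _ fun j hj => (integral_gaussKernel_posterior_inner_add hp s hj).1,
      Finset.sum_congr rfl fun j hj => (integral_gaussKernel_posterior_inner_add hp s hj).2,
      ← integral_finsetSum _ fun j hj =>
        integrable_gaussKernel_posterior_sum hp s hj (d j) (-2 * s) 0, ← integral_const_mul]
    refine integral_congr_ae (ae_of_all _ fun z => ?_)
    simp only [sq_norm_sum_posterior_mul, sub_zero, Finset.mul_sum]
    exact Finset.sum_congr rfl fun j _ => Finset.sum_congr rfl fun k _ => by ring
  · rw [norm_mul, Real.norm_of_nonneg (gaussKernel_pos z).le, Real.norm_eq_abs]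
    refine mul_le_mul_of_nonneg_left ?_ (gaussKernel_pos z).le
    refine abs_sum_posterior_mul_le hp hJ t z fun j hj => ?_
    rw [abs_mul]
    have h1 := abs_real_inner_le_norm (z + t * d j) (d j)
    have h2 : ‖z + t * d j‖ ≤ ‖z‖ + (|s| + 1) * C := by
      refine (norm_add_le _ _).trans ?_
      rw [norm_mul, Complex.norm_real, Real.norm_eq_abs]
      have h3 : |t| ≤ |s| + 1 := by
        rw [Metric.mem_ball, Real.dist_eq] at ht
        have := abs_sub_abs_le_abs_sub t s
        linarith
      have := mul_le_mul h3 (hC j hj) (norm_nonneg _) (by positivity)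
      linarith
    have h3 := mul_le_mul h2 (hC j hj) (norm_nonneg _) (by positivity)
    rw [abs_neg, abs_two]
    nlinarith [sq_nonneg (‖z‖ - C)]

end Mixture

/-! ### Exponential decay from Bhattacharyya overlaps -/

section Mixture

variable {p : ℂ → ℝ} {J : Finset ℂ} {d : ℂ → ℂ}

/-- Completing the square: the parallelogram law for z + w/2 and w/2 gives ‖z‖² + ‖z + w‖² = 2‖z +
w/2‖² + ‖w‖²/2. -/
lemma gaussKernel_mul_exp_half (z w : ℂ) :
    gaussKernel z * Real.exp ((‖z‖ ^ 2 - ‖z + w‖ ^ 2) / 2) =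
      Real.exp (-(‖w‖ ^ 2 / 4)) * gaussKernel (z + w / 2) := by
  unfold gaussKernel
  rw [div_mul_eq_mul_div, ← mul_div_assoc, ← Real.exp_add, ← Real.exp_add]
  congr 2
  have h := parallelogram_law_with_norm ℝ (z + w / 2) (w / 2)
  rw [add_assoc, add_halves, add_sub_cancel_right, norm_div, Complex.norm_two, div_pow] at h
  linarith

lemma integrable_gaussKernel_mul_exp_half (w : ℂ) :
    Integrable fun z => gaussKernel z * Real.exp ((‖z‖ ^ 2 - ‖z + w‖ ^ 2) / 2) := by
  simp only [gaussKernel_mul_exp_half]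
  exact (integrable_gaussKernel.comp_add_right (w / 2)).const_mul _

/-- The Bhattacharyya overlap of two shifted Gaussian kernels. -/
lemma integral_gaussKernel_mul_exp_half (w : ℂ) :
    ∫ z, gaussKernel z * Real.exp ((‖z‖ ^ 2 - ‖z + w‖ ^ 2) / 2) = Real.exp (-(‖w‖ ^ 2 / 4)) := by
  simp only [gaussKernel_mul_exp_half]
  rw [integral_const_mul, integral_add_right_eq_self gaussKernel (w / 2), integral_gaussKernel,
    mul_one]

/-- The likelihood ratio of component j to a reference component i with d_i = 0 is written as a
square r_j², because the estimates below are in terms of r_j, whose Gaussian mean is explicit. -/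
lemma partition_eq_mul_sum_sq (hp : ∀ j ∈ J, 0 < p j) {i : ℂ} (hi : i ∈ J) (a z : ℂ) :
    partition p J d a z = p i * Real.exp (-‖z‖ ^ 2) *
      ∑ j ∈ J, (√(p j / p i) * Real.exp ((‖z‖ ^ 2 - ‖z + a * d j‖ ^ 2) / 2)) ^ 2 := by
  unfold partition
  rw [Finset.mul_sum]
  refine Finset.sum_congr rfl fun j hj => ?_
  rw [mul_pow, Real.sq_sqrt (div_pos (hp j hj) (hp i hi)).le, ← Real.exp_nat_mul]
  have hne := (hp i hi).ne'
  have h : Real.exp (-‖z + a * d j‖ ^ 2) =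
      Real.exp (-‖z‖ ^ 2) * Real.exp ((2 : ℕ) * ((‖z‖ ^ 2 - ‖z + a * d j‖ ^ 2) / 2)) := by
    rw [← Real.exp_add]; congr 1; push_cast; ring
  rw [h]
  field_simp

/-- As r_i = 1, the posterior r_j² / ∑ r_k² is at most r_j² / (1 + r_j²), hence at most r_j since
r_j ≤ 1 + r_j². -/
lemma posterior_le_sqrt_mul_exp (hp : ∀ j ∈ J, 0 < p j) {i j : ℂ} (hi : i ∈ J) (hdi : d i = 0)
    (hj : j ∈ J) (hij : j ≠ i) (a z : ℂ) :
    posterior p J d a j z ≤ √(p j / p i) * Real.exp ((‖z‖ ^ 2 - ‖z + a * d j‖ ^ 2) / 2) := by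
  set r : ℂ → ℝ := fun j => √(p j / p i) * Real.exp ((‖z‖ ^ 2 - ‖z + a * d j‖ ^ 2) / 2) with hr
  have hU := partition_eq_mul_sum_sq (d := d) hp hi a z
  have hUpos := partition_pos (d := d) hp ⟨i, hi⟩ a z
  have hE : 0 < p i * Real.exp (-‖z‖ ^ 2) := mul_pos (hp i hi) (Real.exp_pos _)
  have hri : r i = 1 := by simp [hr, hdi, (hp i hi).ne']
  have hrj : 0 ≤ r j := by positivity
  -- The factorization is applied to the two-point set {j, i}; cancelling the i-th term isolates the
  -- j-th one.
  have hnum : p j * Real.exp (-‖z + a * d j‖ ^ 2) = p i * Real.exp (-‖z‖ ^ 2) * r j ^ 2 := by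
    have := partition_eq_mul_sum_sq (J := {j, i}) (p := p) (d := d)
      (by simpa using ⟨hp j hj, hp i hi⟩) (i := i) (by simp) a z
    simp only [partition] at this
    rw [Finset.sum_pair hij, Finset.sum_pair hij, hdi] at this
    have h1 : √(p i / p i) * Real.exp ((‖z‖ ^ 2 - ‖z + a * 0‖ ^ 2) / 2) = 1 := by
      simp [(hp i hi).ne']
    rw [h1] at this
    simp only [mul_zero, add_zero] at this
    simp only [hr]
    linarith
  have hsum : 1 + r j ^ 2 ≤ ∑ k ∈ J, r k ^ 2 := by
    have : ∑ k ∈ ({j, i} : Finset ℂ), r k ^ 2 ≤ ∑ k ∈ J, r k ^ 2 :=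
      Finset.sum_le_sum_of_subset_of_nonneg
        (by intro k; simp only [Finset.mem_insert, Finset.mem_singleton]; rintro (rfl | rfl) <;> assumption)
        fun _ _ _ => sq_nonneg _
    rw [Finset.sum_pair hij, hri] at this
    linarith
  unfold posterior
  rw [div_le_iff₀ hUpos, hnum, hU]
  have h2 : r j ^ 2 ≤ r j * ∑ k ∈ J, r k ^ 2 := by
    have : r j ≤ ∑ k ∈ J, r k ^ 2 := by nlinarith [sq_nonneg (r j - 1)]
    nlinarith
  calc p i * Real.exp (-‖z‖ ^ 2) * r j ^ 2
      ≤ p i * Real.exp (-‖z‖ ^ 2) * (r j * ∑ k ∈ J, r k ^ 2) := mul_le_mul_of_nonneg_left h2 hE.le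
    _ = _ := by ring

lemma posterior_pos (hp : ∀ j ∈ J, 0 < p j) (a : ℂ) {j : ℂ} (hj : j ∈ J) (z : ℂ) :
    0 < posterior p J d a j z :=
  div_pos (mul_pos (hp j hj) (Real.exp_pos _)) (partition_pos hp ⟨j, hj⟩ a z)

lemma neg_log_posterior_nonneg (hp : ∀ j ∈ J, 0 < p j) (a : ℂ) {j : ℂ} (hj : j ∈ J) (z : ℂ) :
    0 ≤ -Real.log (posterior p J d a j z) :=
  neg_nonneg.2 (Real.log_nonpos (posterior_nonneg hp a hj z) (posterior_le_one hp a hj z))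

lemma neg_log_posterior_eq (hp : ∀ j ∈ J, 0 < p j) {i : ℂ} (hi : i ∈ J) (hdi : d i = 0) (a z : ℂ) :
    -Real.log (posterior p J d a i z) =
      Real.log (partition p J d a z) + (‖z‖ ^ 2 - Real.log (p i)) := by
  unfold posterior
  rw [hdi, mul_zero, add_zero, Real.log_div (mul_pos (hp i hi) (Real.exp_pos _)).ne'
    (partition_pos hp ⟨i, hi⟩ a z).ne', Real.log_mul (hp i hi).ne' (Real.exp_pos _).ne',
    Real.log_exp]
  ring

/-- The left side is log ∑ r_j² ≤ 2 log ∑ r_j ≤ 2 (∑ r_j - 1), and r_i = 1 removes the i-th term. -/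
lemma neg_log_posterior_le (hp : ∀ j ∈ J, 0 < p j) {i : ℂ} (hi : i ∈ J) (hdi : d i = 0)
    (a z : ℂ) :
    -Real.log (posterior p J d a i z) ≤ 2 * ∑ j ∈ J.erase i,
      √(p j / p i) * Real.exp ((‖z‖ ^ 2 - ‖z + a * d j‖ ^ 2) / 2) := by
  set r : ℂ → ℝ := fun j => √(p j / p i) * Real.exp ((‖z‖ ^ 2 - ‖z + a * d j‖ ^ 2) / 2) with hr
  have hE : 0 < p i * Real.exp (-‖z‖ ^ 2) := mul_pos (hp i hi) (Real.exp_pos _)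
  have hr0 : ∀ j, 0 ≤ r j := fun j => by positivity
  have hri : r i = 1 := by simp [hr, hdi, (hp i hi).ne']
  have hpost : posterior p J d a i z = (∑ j ∈ J, r j ^ 2)⁻¹ := by
    unfold posterior
    rw [partition_eq_mul_sum_sq hp hi a z, hdi, mul_zero, add_zero, ← div_div, div_self hE.ne',
      one_div]
  have h1 : (1 : ℝ) ≤ ∑ j ∈ J, r j := by
    rw [← hri]; exact Finset.single_le_sum (f := r) (fun j _ => hr0 j) hi
  have h0 : 0 < ∑ j ∈ J, r j ^ 2 := by
    refine lt_of_lt_of_le one_pos ?_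
    have := Finset.single_le_sum (f := fun j => r j ^ 2) (fun j _ => sq_nonneg _) hi
    simpa [hri] using this
  have h2 : ∑ j ∈ J, r j ^ 2 ≤ (∑ j ∈ J, r j) ^ 2 := by
    rw [sq (∑ j ∈ J, r j), Finset.sum_mul]
    refine Finset.sum_le_sum fun j hj => ?_
    rw [sq]
    exact mul_le_mul_of_nonneg_left (Finset.single_le_sum (f := r) (fun j _ => hr0 j) hj) (hr0 j)
  rw [hpost, Real.log_inv, neg_neg]
  calc Real.log (∑ j ∈ J, r j ^ 2) ≤ Real.log ((∑ j ∈ J, r j) ^ 2) := Real.log_le_log h0 h2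
    _ = 2 * Real.log (∑ j ∈ J, r j) := by rw [Real.log_pow]; norm_num
    _ ≤ 2 * (∑ j ∈ J, r j - 1) := by
      have := Real.log_le_sub_one_of_pos (lt_of_lt_of_le one_pos h1); linarith
    _ = 2 * ∑ j ∈ J.erase i, r j := by
      rw [← Finset.add_sum_erase J r hi, hri]; ring

/-- The reference centre is 0, so the posterior mean has norm at most D Q, with Q the posterior mass
of the other points. Then Q² ≤ Q, and Q is bounded by the overlaps. -/
lemma sq_norm_sum_posterior_le (hp : ∀ j ∈ J, 0 < p j) {i : ℂ} (hi : i ∈ J) (hdi : d i = 0)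
    (a z : ℂ) :
    ‖∑ j ∈ J, (posterior p J d a j z : ℂ) * d j‖ ^ 2 ≤ (∑ j ∈ J, ‖d j‖) ^ 2 *
      ∑ j ∈ J.erase i, √(p j / p i) * Real.exp ((‖z‖ ^ 2 - ‖z + a * d j‖ ^ 2) / 2) := by
  set D := ∑ j ∈ J, ‖d j‖
  have hD0 : 0 ≤ D := Finset.sum_nonneg fun _ _ => norm_nonneg _
  set Q := ∑ j ∈ J.erase i, posterior p J d a j z with hQ
  have hQ0 : 0 ≤ Q :=
    Finset.sum_nonneg fun j hj => posterior_nonneg hp a (Finset.mem_of_mem_erase hj) z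
  have hQ1 : Q ≤ 1 := by
    have h := sum_posterior (d := d) hp ⟨i, hi⟩ a z
    rw [← Finset.add_sum_erase _ _ hi] at h
    linarith [posterior_nonneg (d := d) hp a hi z]
  have h1 : ‖∑ j ∈ J, (posterior p J d a j z : ℂ) * d j‖ ≤ D * Q := by
    rw [← Finset.add_sum_erase _ _ hi, hdi, mul_zero, zero_add, hQ, Finset.mul_sum]
    refine (norm_sum_le _ _).trans (Finset.sum_le_sum fun j hj => ?_)
    have hj' := Finset.mem_of_mem_erase hj
    rw [norm_mul, Complex.norm_real, Real.norm_of_nonneg (posterior_nonneg hp a hj' z), mul_comm]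
    exact mul_le_mul_of_nonneg_right
      (Finset.single_le_sum (f := fun j => ‖d j‖) (fun _ _ => norm_nonneg _) hj')
      (posterior_nonneg hp a hj' z)
  have h2 : Q ≤ ∑ j ∈ J.erase i, √(p j / p i) * Real.exp ((‖z‖ ^ 2 - ‖z + a * d j‖ ^ 2) / 2) :=
    Finset.sum_le_sum fun j hj => posterior_le_sqrt_mul_exp hp hi hdi
      (Finset.mem_of_mem_erase hj) (Finset.ne_of_mem_erase hj) a z
  calc ‖∑ j ∈ J, (posterior p J d a j z : ℂ) * d j‖ ^ 2 ≤ (D * Q) ^ 2 := by gcongr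
    _ = D ^ 2 * (Q * Q) := by ring
    _ ≤ D ^ 2 * (Q * 1) := by gcongr
    _ = D ^ 2 * Q := by rw [mul_one]
    _ ≤ _ := by gcongr

lemma integrable_overlap_sum (i a : ℂ) :
    Integrable fun z => gaussKernel z *
      ∑ j ∈ J.erase i, √(p j / p i) * Real.exp ((‖z‖ ^ 2 - ‖z + a * d j‖ ^ 2) / 2) := by
  simp only [Finset.mul_sum, mul_left_comm (gaussKernel _)]
  exact integrable_finsetSum _ fun j _ =>
    (integrable_gaussKernel_mul_exp_half (a * d j)).const_mul _

lemma integral_overlap_sum (i a : ℂ) :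
    ∫ z, gaussKernel z *
      ∑ j ∈ J.erase i, √(p j / p i) * Real.exp ((‖z‖ ^ 2 - ‖z + a * d j‖ ^ 2) / 2) =
    ∑ j ∈ J.erase i, √(p j / p i) * Real.exp (-(‖a * d j‖ ^ 2 / 4)) := by
  simp only [Finset.mul_sum, mul_left_comm (gaussKernel _)]
  rw [integral_finsetSum _ fun j _ =>
    (integrable_gaussKernel_mul_exp_half (a * d j)).const_mul _]
  simp only [integral_const_mul, integral_gaussKernel_mul_exp_half]

lemma continuous_neg_log_posterior (hp : ∀ j ∈ J, 0 < p j) (a : ℂ) {j : ℂ} (hj : j ∈ J) :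
    Continuous fun z => -Real.log (posterior p J d a j z) :=
  ((continuous_posterior hp ⟨j, hj⟩ a j).log fun z => (posterior_pos hp a hj z).ne').neg

lemma integrable_neg_log_posterior (hp : ∀ j ∈ J, 0 < p j) {i : ℂ} (hi : i ∈ J) (hdi : d i = 0)
    (a : ℂ) : Integrable fun z => gaussKernel z * -Real.log (posterior p J d a i z) := by
  refine ((integrable_overlap_sum (p := p) (J := J) (d := d) i a).const_mul 2).mono'
    (continuous_gaussKernel.mul (continuous_neg_log_posterior hp a hi)).aestronglyMeasurable
    (ae_of_all _ fun z => ?_)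
  rw [Real.norm_of_nonneg (mul_nonneg (gaussKernel_pos z).le (neg_log_posterior_nonneg hp a hi z)),
    mul_left_comm]
  exact mul_le_mul_of_nonneg_left (neg_log_posterior_le hp hi hdi a z) (gaussKernel_pos z).le

lemma integral_neg_log_posterior_le (hp : ∀ j ∈ J, 0 < p j) {i : ℂ} (hi : i ∈ J) (hdi : d i = 0)
    (a : ℂ) :
    ∫ z, gaussKernel z * -Real.log (posterior p J d a i z) ≤
      2 * ∑ j ∈ J.erase i, √(p j / p i) * Real.exp (-(‖a * d j‖ ^ 2 / 4)) := by
  rw [← integral_overlap_sum, ← integral_const_mul]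
  refine integral_mono (integrable_neg_log_posterior hp hi hdi a)
    ((integrable_overlap_sum i a).const_mul 2) fun z => ?_
  simp only [mul_left_comm (2 : ℝ)]
  exact mul_le_mul_of_nonneg_left (neg_log_posterior_le hp hi hdi a z) (gaussKernel_pos z).le

lemma integral_sq_norm_sum_posterior_le (hp : ∀ j ∈ J, 0 < p j) {i : ℂ} (hi : i ∈ J)
    (hdi : d i = 0) (a : ℂ) :
    ∫ z, gaussKernel z * ‖∑ j ∈ J, (posterior p J d a j z : ℂ) * d j‖ ^ 2 ≤
      (∑ j ∈ J, ‖d j‖) ^ 2 *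
        ∑ j ∈ J.erase i, √(p j / p i) * Real.exp (-(‖a * d j‖ ^ 2 / 4)) := by
  rw [← integral_overlap_sum, ← integral_const_mul]
  refine integral_mono_of_nonneg
    (ae_of_all _ fun z => mul_nonneg (gaussKernel_pos z).le (sq_nonneg _))
    ((integrable_overlap_sum i a).const_mul _) (ae_of_all _ fun z => ?_)
  simp only [mul_left_comm ((∑ j ∈ J, ‖d j‖) ^ 2)]
  exact mul_le_mul_of_nonneg_left (sq_norm_sum_posterior_le hp hi hdi a z) (gaussKernel_pos z).le

end Mixture

/-! ### Equivocation and mean square error at a fixed gain -/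

section Equivocation

variable (p : ℂ → ℝ) (S : Finset ℂ)

/-- The equivocation `H(x | a x + n)` of an input with law `p` on `S` and standard complex
Gaussian noise. -/
def equivocation (a : ℂ) : ℝ :=
  ∑ i ∈ S, p i * ∫ z, gaussKernel z * -Real.log (posterior p S (fun j => i - j) a i z)

/-- The mean square error of the conditional mean estimator of `x` given `a x + n`. -/
def meanSquareError (a : ℂ) : ℝ :=
  ∑ i ∈ S, p i * ∫ z, gaussKernel z *
    ‖∑ j ∈ S, (posterior p S (fun j => i - j) a j z : ℂ) * (i - j)‖ ^ 2

variable {p S}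

lemma equivocation_nonneg (hp : ∀ j ∈ S, 0 < p j) (a : ℂ) : 0 ≤ equivocation p S a :=
  Finset.sum_nonneg fun i hi => mul_nonneg (hp i hi).le (integral_nonneg fun z =>
    mul_nonneg (gaussKernel_pos z).le (neg_log_posterior_nonneg hp a hi z))

lemma meanSquareError_nonneg (hp : ∀ j ∈ S, 0 < p j) (a : ℂ) : 0 ≤ meanSquareError p S a :=
  Finset.sum_nonneg fun i hi => mul_nonneg (hp i hi).le (integral_nonneg fun z =>
    mul_nonneg (gaussKernel_pos z).le (sq_nonneg _))

/-- The derivative of the mutual information is the minimum mean square error. -/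
theorem hasDerivAt_equivocation (hp : ∀ j ∈ S, 0 < p j) (hsum : ∑ j ∈ S, p j = 1) (s : ℝ) :
    HasDerivAt (fun s : ℝ => equivocation p S s) (-2 * s * meanSquareError p S s) s := by
  unfold equivocation meanSquareError
  rw [Finset.mul_sum]
  refine HasDerivAt.fun_sum fun i hi => ?_
  rw [mul_left_comm]
  refine HasDerivAt.const_mul (p i) ?_
  have hdi : (fun j => i - j) i = 0 := sub_self i
  have h := (hasDerivAt_integral_log_partition (d := fun j => i - j) hp hsum hi hdi s).add_const
    (∫ z, gaussKernel z * (‖z‖ ^ 2 - Real.log (p i)))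
  refine h.congr_of_eventuallyEq (Eventually.of_forall fun t => ?_)
  simp only [neg_log_posterior_eq (d := fun j => i - j) hp hi hdi, mul_add]
  have hl : Continuous fun z => Real.log (partition p S (fun j => i - j) t z) :=
    (continuous_partition _).log fun z => (partition_pos hp ⟨i, hi⟩ _ z).ne'
  refine integral_add (integrable_gaussKernel_mul_of_le hl.aestronglyMeasurable
    (abs_log_partition_le hp hsum hi hdi t)) ?_
  refine integrable_gaussKernel_mul_of_le (A := |Real.log (p i)|) (B := 1) (by fun_prop)
    fun z => ?_
  refine (abs_sub _ _).trans ?_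
  rw [abs_of_nonneg (sq_nonneg ‖z‖)]; linarith

/-- The rate c is at most a quarter of every squared distance between distinct points, so every
overlap is at most exp(-c ‖a‖²). -/
lemma exists_mul_exp_bound (hp : ∀ j ∈ S, 0 < p j) :
    ∃ K c : ℝ, 0 ≤ K ∧ 0 < c ∧ ∀ a : ℂ, equivocation p S a ≤ K * Real.exp (-(c * ‖a‖ ^ 2)) ∧
      meanSquareError p S a ≤ K * Real.exp (-(c * ‖a‖ ^ 2)) := by
  obtain ⟨c, hc0, hc⟩ : ∃ c : ℝ, 0 < c ∧ ∀ i ∈ S, ∀ j ∈ S.erase i, c ≤ ‖i - j‖ ^ 2 / 4 := by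
    -- Induction over pairs also covers a one-point support, which has no pair and takes c = 1.
    have : ∀ T : Finset (ℂ × ℂ), (∀ q ∈ T, q.1 ≠ q.2) →
        ∃ c : ℝ, 0 < c ∧ ∀ q ∈ T, c ≤ ‖q.1 - q.2‖ ^ 2 / 4 := by
      intro T
      induction T using Finset.induction_on with
      | empty => exact fun _ => ⟨1, one_pos, by simp⟩
      | insert q T _ ih =>
        intro h
        obtain ⟨c, h0, h1⟩ := ih fun r hr => h r (Finset.mem_insert_of_mem hr)
        have hq : 0 < ‖q.1 - q.2‖ ^ 2 / 4 := by
          have := norm_pos_iff.2 (sub_ne_zero.2 (h q (Finset.mem_insert_self _ _)))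
          positivity
        refine ⟨min c (‖q.1 - q.2‖ ^ 2 / 4), lt_min h0 hq, fun r hr => ?_⟩
        rcases Finset.mem_insert.1 hr with rfl | hr
        · exact min_le_right _ _
        · exact (min_le_left _ _).trans (h1 r hr)
    obtain ⟨c, h0, h1⟩ := this S.offDiag fun q hq => (Finset.mem_offDiag.1 hq).2.2
    exact ⟨c, h0, fun i hi j hj => h1 (i, j) (Finset.mem_offDiag.2
      ⟨hi, Finset.mem_of_mem_erase hj, (Finset.ne_of_mem_erase hj).symm⟩)⟩
  have hov : ∀ a : ℂ, ∀ i ∈ S, ∑ j ∈ S.erase i, √(p j / p i) * Real.exp (-(‖a * (i - j)‖ ^ 2 / 4))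
      ≤ (∑ j ∈ S.erase i, √(p j / p i)) * Real.exp (-(c * ‖a‖ ^ 2)) := by
    intro a i hi
    rw [Finset.sum_mul]
    refine Finset.sum_le_sum fun j hj => mul_le_mul_of_nonneg_left ?_ (Real.sqrt_nonneg _)
    rw [Real.exp_le_exp, neg_le_neg_iff, norm_mul, mul_pow]
    nlinarith [hc i hi j hj, sq_nonneg ‖a‖]
  have hB : ∀ i, 0 ≤ ∑ j ∈ S.erase i, √(p j / p i) := fun i =>
    Finset.sum_nonneg fun _ _ => Real.sqrt_nonneg _
  -- The factor 2 + D² serves both bounds: 2 comes from the logarithm, D² from the diameter of the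
  -- posterior mean.
  refine ⟨∑ i ∈ S, p i * ((2 + (∑ j ∈ S, ‖i - j‖) ^ 2) * ∑ j ∈ S.erase i, √(p j / p i)), c,
    Finset.sum_nonneg fun i hi => mul_nonneg (hp i hi).le (mul_nonneg (by positivity) (hB i)), hc0,
    fun a => ⟨?_, ?_⟩⟩
  · unfold equivocation
    rw [Finset.sum_mul]
    refine Finset.sum_le_sum fun i hi => ?_
    rw [mul_assoc]
    refine mul_le_mul_of_nonneg_left ?_ (hp i hi).le
    refine (integral_neg_log_posterior_le (d := fun j => i - j) hp hi (sub_self i) a).trans ?_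
    rw [mul_assoc]
    exact mul_le_mul (by nlinarith [sq_nonneg (∑ j ∈ S, ‖i - j‖)]) (hov a i hi)
      (Finset.sum_nonneg fun _ _ => by positivity) (by positivity)
  · unfold meanSquareError
    rw [Finset.sum_mul]
    refine Finset.sum_le_sum fun i hi => ?_
    rw [mul_assoc]
    refine mul_le_mul_of_nonneg_left ?_ (hp i hi).le
    refine (integral_sq_norm_sum_posterior_le (d := fun j => i - j) hp hi (sub_self i) a).trans ?_
    rw [mul_assoc]
    exact mul_le_mul (by linarith) (hov a i hi)
      (Finset.sum_nonneg fun _ _ => by positivity) (by positivity)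

/-- Rotating the gain and the noise together leaves every distance unchanged. With the rotation
invariance of the Gaussian kernel, this removes the phase of the gain. -/
lemma posterior_mul_circle (d : ℂ → ℂ) (u : Circle) (a j z : ℂ) :
    posterior p S d (u * a) j (u * z) = posterior p S d a j z := by
  have h : ∀ k, ‖(u : ℂ) * z + u * a * d k‖ = ‖z + a * d k‖ := fun k => by
    rw [mul_assoc, ← mul_add, norm_mul, Circle.norm_coe, one_mul]
  simp only [posterior, partition, h]

lemma equivocation_mul_circle (u : Circle) (a : ℂ) :
    equivocation p S (u * a) = equivocation p S a := by
  unfold equivocation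
  refine Finset.sum_congr rfl fun i _ => ?_
  congr 1
  have := (rotation u).measurePreserving.integral_comp
    (rotation u).toHomeomorph.measurableEmbedding
    (fun z => gaussKernel z * -Real.log (posterior p S (fun j => i - j) (u * a) i z))
  rw [← this]
  refine integral_congr_ae (ae_of_all _ fun z => ?_)
  have h : gaussKernel (u * z) = gaussKernel z := by
    unfold gaussKernel; rw [norm_mul, Circle.norm_coe, one_mul]
  simp only [rotation_apply, posterior_mul_circle, h]

lemma equivocation_eq_norm (a : ℂ) : equivocation p S a = equivocation p S (‖a‖ : ℝ) := by
  calc equivocation p S a = equivocation p S (Circle.exp a.arg * (‖a‖ : ℝ)) := by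
        rw [Circle.coe_exp, mul_comm, Complex.norm_mul_exp_arg_mul_I]
    _ = _ := equivocation_mul_circle _ _

end Equivocation

/-! ### Density of the complex Gaussian law -/

lemma _root_.MeasureTheory.MeasurePreserving.map_withDensity_comp {α β : Type*}
    [MeasurableSpace α] [MeasurableSpace β] {μ : Measure α} {ν : Measure β} {e : α → β}
    (he : MeasurePreserving e μ ν) {f : β → ENNReal} (hf : Measurable f) :
    (μ.withDensity (f ∘ e)).map e = ν.withDensity f := by
  ext s hs
  rw [Measure.map_apply he.measurable hs, withDensity_apply _ (he.measurable hs),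
    withDensity_apply _ hs]
  exact he.setLIntegral_comp_preimage hs hf

lemma complexGaussian_eq_withDensity (ν : ℂ) {v : NNReal} (hv : v ≠ 0) :
    complexGaussian ν v = volume.withDensity
      (fun z => ENNReal.ofReal (Real.exp (-(‖z - ν‖ ^ 2 / v)) / (Real.pi * v))) := by
  have hv2 : v / 2 ≠ 0 := by simpa using hv
  have hvpos : (0 : ℝ) < v := by exact_mod_cast pos_iff_ne_zero.2 hv
  have hmp : MeasurePreserving (fun q : ℝ × ℝ => (q.1 : ℂ) + (q.2 : ℂ) * Complex.I)
      (volume.prod volume) volume := by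
    have h := Complex.volume_preserving_equiv_real_prod.symm
    have h2 : ⇑Complex.measurableEquivRealProd.symm
        = fun q : ℝ × ℝ => (q.1 : ℂ) + (q.2 : ℂ) * Complex.I := by
      ext1 q
      exact Complex.ext (by simp [Complex.measurableEquivRealProd])
        (by simp [Complex.measurableEquivRealProd])
    rw [h2] at h
    exact h
  rw [complexGaussian, gaussianReal_of_var_ne_zero _ hv2, gaussianReal_of_var_ne_zero _ hv2,
    prod_withDensity (measurable_gaussianPDF _ _) (measurable_gaussianPDF _ _),
    ← hmp.map_withDensity_comp (by fun_prop)]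
  congr 2
  ext q
  simp only [Function.comp, gaussianPDF]
  rw [← ENNReal.ofReal_mul (gaussianPDFReal_nonneg _ _ _)]
  congr 1
  have h1 : ‖(q.1 : ℂ) + (q.2 : ℂ) * Complex.I - ν‖ ^ 2 = (q.1 - ν.re) ^ 2 + (q.2 - ν.im) ^ 2 := by
    rw [← Complex.normSq_eq_norm_sq, Complex.normSq_apply]; simp
    ring
  rw [h1, gaussianPDFReal, gaussianPDFReal]
  have h2 : 2 * Real.pi * ((v / 2 : NNReal) : ℝ) = Real.pi * v := by push_cast; ring
  have h3 : (2 : ℝ) * ((v / 2 : NNReal) : ℝ) = v := by push_cast; ring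
  rw [h2, h3, mul_mul_mul_comm, ← mul_inv, Real.mul_self_sqrt (by positivity), ← Real.exp_add,
    div_eq_inv_mul (Real.exp _) (Real.pi * v)]
  congr 2
  ring

lemma complexGaussian_zero_one :
    complexGaussian 0 1 = volume.withDensity (fun z => ENNReal.ofReal (gaussKernel z)) := by
  rw [complexGaussian_eq_withDensity 0 one_ne_zero]
  simp [gaussKernel]

/-- The probability mass function of a random variable. -/
def pmfOf {Ω : Type*} [MeasurableSpace Ω] (P : Measure Ω) (x : Ω → ℂ) (a : ℂ) : ℝ :=
  P.real (x ⁻¹' {a})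

lemma pmfOf_nonneg {Ω : Type*} [MeasurableSpace Ω] {P : Measure Ω} {x : Ω → ℂ} (a : ℂ) :
    0 ≤ pmfOf P x a :=
  measureReal_nonneg

/-! ### Joint law of input and noise; conditional mean estimation -/

section Laws

variable {Ω : Type*} [MeasurableSpace Ω] {P : Measure Ω} [IsProbabilityMeasure P]
  {x h n : Ω → ℂ} {S : Finset ℂ}

lemma measurable_ofReal_gaussKernel : Measurable fun z => ENNReal.ofReal (gaussKernel z) :=
  continuous_gaussKernel.measurable.ennreal_ofReal

lemma lintegral_withDensity_gaussKernel {f : ℂ → ENNReal} (hf : Measurable f) :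
    ∫⁻ z, f z ∂(volume.withDensity fun z => ENNReal.ofReal (gaussKernel z)) =
      ∫⁻ z, ENNReal.ofReal (gaussKernel z) * f z :=
  lintegral_withDensity_eq_lintegral_mul _ measurable_ofReal_gaussKernel hf

lemma lintegral_input (hx : Measurable x) (hS : HasFiniteSupport P x S) (f : ℂ → ENNReal) :
    ∫⁻ a, f a ∂(P.map x) = ∑ i ∈ S, ENNReal.ofReal (pmfOf P x i) * f i := by
  have h1 : ∀ᵐ a ∂(P.map x), a ∈ (S : Set ℂ) :=
    (ae_map_iff hx.aemeasurable S.measurableSet).2 hS.1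
  rw [← Measure.restrict_eq_self_of_ae_mem h1, lintegral_finset]
  refine Finset.sum_congr rfl fun i _ => ?_
  rw [mul_comm, Measure.map_apply hx (measurableSet_singleton i), pmfOf, ofReal_measureReal]

lemma sum_pmfOf (hx : Measurable x) (hS : HasFiniteSupport P x S) :
    ∑ i ∈ S, pmfOf P x i = 1 := by
  have := Measure.isProbabilityMeasure_map (μ := P) hx.aemeasurable
  have h1 := lintegral_input hx hS fun _ => 1
  simp only [lintegral_const, measure_univ, mul_one] at h1
  rw [← ENNReal.ofReal_sum_of_nonneg fun i _ => pmfOf_nonneg i] at h1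
  exact (ENNReal.ofReal_eq_one.1 h1.symm)

lemma lintegral_input_noise (hx : Measurable x) (hn : Measurable n) (hind : IndepFun x n P)
    (hnoise : P.map n = complexGaussian 0 1) (hS : HasFiniteSupport P x S)
    {f : ℂ × ℂ → ENNReal} (hf : Measurable f) :
    ∫⁻ ω, f (x ω, n ω) ∂P =
      ∑ i ∈ S, ENNReal.ofReal (pmfOf P x i) * ∫⁻ z, ENNReal.ofReal (gaussKernel z) * f (i, z) := by
  rw [← lintegral_map (f := f) (g := fun ω => (x ω, n ω)) hf (hx.prodMk hn),
    (indepFun_iff_map_prod_eq_prod_map_map hx.aemeasurable hn.aemeasurable).1 hind, hnoise,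
    complexGaussian_zero_one]
  have := isFiniteMeasure_withDensity_ofReal (μ := volume) integrable_gaussKernel.2
  rw [lintegral_prod _ hf.aemeasurable, lintegral_input hx hS]
  refine Finset.sum_congr rfl fun i _ => ?_
  rw [lintegral_withDensity_gaussKernel (f := fun z => f (i, z))
    (hf.comp measurable_prodMk_left)]

lemma map_input_noise (hx : Measurable x) (hn : Measurable n) (hind : IndepFun x n P)
    (hnoise : P.map n = complexGaussian 0 1) (hS : HasFiniteSupport P x S) :
    P.map (fun ω => (x ω, n ω)) = ∑ i ∈ S, ENNReal.ofReal (pmfOf P x i) •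
      (volume.withDensity (fun z => ENNReal.ofReal (gaussKernel z))).map (Prod.mk i) := by
  refine Measure.ext_of_lintegral _ fun f hf => ?_
  rw [lintegral_map hf (hx.prodMk hn), lintegral_input_noise hx hn hind hnoise hS hf,
    lintegral_finsetSum_measure]
  refine Finset.sum_congr rfl fun i _ => ?_
  rw [lintegral_smul_measure, lintegral_map hf measurable_prodMk_left,
    lintegral_withDensity_gaussKernel (f := fun z => f (i, z))
    (hf.comp measurable_prodMk_left), smul_eq_mul]

lemma integral_input_noise {E : Type*} [NormedAddCommGroup E] [NormedSpace ℝ E]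
    (hx : Measurable x) (hn : Measurable n) (hind : IndepFun x n P)
    (hnoise : P.map n = complexGaussian 0 1) (hS : HasFiniteSupport P x S) {F : ℂ × ℂ → E}
    (hF : StronglyMeasurable F) (hint : ∀ i ∈ S, Integrable fun z => gaussKernel z • F (i, z)) :
    Integrable (fun ω => F (x ω, n ω)) P ∧
    ∫ ω, F (x ω, n ω) ∂P = ∑ i ∈ S, pmfOf P x i • ∫ z, gaussKernel z • F (i, z) := by
  have hxn : Measurable fun ω => (x ω, n ω) := hx.prodMk hn
  have htr : ∀ z, (ENNReal.ofReal (gaussKernel z)).toReal = gaussKernel z := fun z =>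
    ENNReal.toReal_ofReal (gaussKernel_pos z).le
  have hI : ∀ i ∈ S, Integrable F (ENNReal.ofReal (pmfOf P x i) •
      (volume.withDensity (fun z => ENNReal.ofReal (gaussKernel z))).map (Prod.mk i)) := by
    intro i hi
    refine Integrable.smul_measure ?_ ENNReal.ofReal_ne_top
    rw [integrable_map_measure hF.aestronglyMeasurable measurable_prodMk_left.aemeasurable,
      integrable_withDensity_iff_integrable_smul' measurable_ofReal_gaussKernel (ae_of_all _ fun _ => ENNReal.ofReal_lt_top)]
    simpa only [htr, Function.comp_apply] using hint i hi
  have hI' : Integrable F (P.map fun ω => (x ω, n ω)) := by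
    rw [map_input_noise hx hn hind hnoise hS, integrable_finsetSum_measure]
    exact hI
  refine ⟨(integrable_map_measure hF.aestronglyMeasurable hxn.aemeasurable).1 hI', ?_⟩
  rw [← integral_map hxn.aemeasurable hF.aestronglyMeasurable,
    map_input_noise hx hn hind hnoise hS, integral_finsetSum_measure hI]
  refine Finset.sum_congr rfl fun i _ => ?_
  rw [integral_smul_measure, integral_map measurable_prodMk_left.aemeasurable
    hF.aestronglyMeasurable, integral_withDensity_eq_integral_toReal_smul measurable_ofReal_gaussKernel
    (ae_of_all _ fun _ => ENNReal.ofReal_lt_top), ENNReal.toReal_ofReal (pmfOf_nonneg i)]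
  simp only [htr]

/-- Centres -j describe the mixture in the output variable y; centres i - j describe it in the noise
variable z when i was sent. The substitution y = a i + z links the two. -/
lemma partition_add_mul (p : ℂ → ℝ) (a i z : ℂ) :
    partition p S (fun j => -j) a (a * i + z) = partition p S (fun j => i - j) a z := by
  have h : ∀ j, a * i + z + a * -j = z + a * (i - j) := fun j => by ring
  simp only [partition, h]

lemma posterior_add_mul (p : ℂ → ℝ) (a i j z : ℂ) :
    posterior p S (fun j => -j) a j (a * i + z) = posterior p S (fun j => i - j) a j z := by
  have h : ∀ j, a * i + z + a * -j = z + a * (i - j) := fun j => by ring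
  simp only [posterior, partition_add_mul, h]

/-- The conditional mean of the input given the output `y` at gain `a`. -/
def conditionalMean (p : ℂ → ℝ) (S : Finset ℂ) (a y : ℂ) : ℂ :=
  ∑ j ∈ S, (posterior p S (fun j => -j) a j y : ℂ) * j

section Estimation

variable {p : ℂ → ℝ}

lemma continuous_conditionalMean (hp : ∀ j ∈ S, 0 < p j) (hne : S.Nonempty) (a : ℂ) :
    Continuous (conditionalMean p S a) :=
  continuous_finsetSum _ fun j _ => (Complex.continuous_ofReal.comp
    (continuous_posterior hp hne a j)).mul continuous_const

lemma norm_conditionalMean_le (hp : ∀ j ∈ S, 0 < p j) (a y : ℂ) :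
    ‖conditionalMean p S a y‖ ≤ ∑ j ∈ S, ‖j‖ := by
  refine (norm_sum_le _ _).trans (Finset.sum_le_sum fun j hj => ?_)
  rw [norm_mul, Complex.norm_real, Real.norm_eq_abs]
  exact mul_le_of_le_one_left (norm_nonneg _) (abs_posterior_le_one hp a hj y)

lemma sub_conditionalMean (hp : ∀ j ∈ S, 0 < p j) (hne : S.Nonempty) (a i z : ℂ) :
    i - conditionalMean p S a (a * i + z) =
      ∑ j ∈ S, (posterior p S (fun j => i - j) a j z : ℂ) * (i - j) := by
  unfold conditionalMean
  simp only [posterior_add_mul, mul_sub, Finset.sum_sub_distrib, ← Finset.sum_mul]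
  rw [← Complex.ofReal_sum, sum_posterior hp hne, Complex.ofReal_one, one_mul]

/-- Bayes' rule: p_i times the noise density at y - a i is the posterior times a factor independent
of i, so this is the posterior mean of a centred quantity. -/
lemma sum_weight_mul_conditionalMean_sub (hp : ∀ j ∈ S, 0 < p j) (hne : S.Nonempty) (a y : ℂ) :
    ∑ i ∈ S, p i • (gaussKernel (y - a * i) • (conditionalMean p S a y - i)) = 0 := by
  have hU := (partition_pos (d := fun j => -j) hp hne a y).ne'
  have hg : ∀ i, p i * gaussKernel (y - a * i) =
      posterior p S (fun j => -j) a i y * (partition p S (fun j => -j) a y / Real.pi) := by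
    intro i
    unfold posterior gaussKernel
    rw [mul_neg, ← sub_eq_add_neg]
    field_simp
  simp only [smul_smul, hg, mul_comm (posterior _ _ _ _ _ _)]
  simp only [mul_smul]
  rw [← Finset.smul_sum]
  simp only [smul_sub, Finset.sum_sub_distrib, ← Finset.sum_smul]
  rw [sum_posterior hp hne, one_smul, conditionalMean]
  simp only [Complex.real_smul, sub_self]

end Estimation

/-- The orthogonality that characterizes conditional expectation. After each noise integral is
shifted to the output variable, the sum over inputs vanishes pointwise. -/
lemma setIntegral_conditionalMean (hx : Measurable x) (hn : Measurable n) (hind : IndepFun x n P)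
    (hnoise : P.map n = complexGaussian 0 1) (hS : HasFiniteSupport P x S) (hne : S.Nonempty)
    (a : ℂ) {B : Set ℂ} (hB : MeasurableSet B) :
    ∫ ω, B.indicator (fun _ => (1 : ℝ)) (a * x ω + n ω) •
      (conditionalMean (pmfOf P x) S a (a * x ω + n ω) - x ω) ∂P = 0 := by
  set p := pmfOf P x
  have hp : ∀ j ∈ S, 0 < p j := hS.2
  have hcm := continuous_conditionalMean hp hne a
  have hBi : Measurable (B.indicator (fun _ => (1 : ℝ))) := measurable_const.indicator hB
  have hmeas : Measurable fun q : ℂ × ℂ => B.indicator (fun _ => (1 : ℝ)) (a * q.1 + q.2) •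
      (conditionalMean p S a (a * q.1 + q.2) - q.1) := by
    have h1 : Measurable fun q : ℂ × ℂ => a * q.1 + q.2 := by fun_prop
    exact (hBi.comp h1).smul ((hcm.measurable.comp h1).sub measurable_fst)
  have hint : ∀ i ∈ S, Integrable fun z => gaussKernel z •
      (B.indicator (fun _ => (1 : ℝ)) (a * i + z) • (conditionalMean p S a (a * i + z) - i)) := by
    intro i _
    refine (integrable_gaussKernel.mul_const (∑ j ∈ S, ‖j‖ + ‖i‖)).mono'
      (continuous_gaussKernel.measurable.smul (hmeas.comp measurable_prodMk_left)).aestronglyMeasurable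
      (ae_of_all _ fun z => ?_)
    rw [norm_smul, Real.norm_of_nonneg (gaussKernel_pos z).le, norm_smul]
    refine mul_le_mul_of_nonneg_left ?_ (gaussKernel_pos z).le
    have h1 : ‖B.indicator (fun _ => (1 : ℝ)) (a * i + z)‖ ≤ 1 := by
      by_cases hz : a * i + z ∈ B <;> simp [hz]
    have h2 := (norm_sub_le (conditionalMean p S a (a * i + z)) i).trans
      (add_le_add_left (norm_conditionalMean_le hp a (a * i + z)) _)
    exact (mul_le_of_le_one_left (norm_nonneg _) h1).trans h2
  rw [(integral_input_noise hx hn hind hnoise hS hmeas.stronglyMeasurable hint).2]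
  have hshift : ∀ i ∈ S, Integrable (fun y => gaussKernel (y - a * i) •
      (B.indicator (fun _ => (1 : ℝ)) y • (conditionalMean p S a y - i))) ∧
      ∫ z, gaussKernel z • (B.indicator (fun _ => (1 : ℝ)) (a * i + z) •
        (conditionalMean p S a (a * i + z) - i)) = ∫ y, gaussKernel (y - a * i) •
      (B.indicator (fun _ => (1 : ℝ)) y • (conditionalMean p S a y - i)) := by
    intro i hi
    have := (hint i hi).comp_sub_right (a * i)
    simp only [add_sub_cancel] at this
    refine ⟨this, ?_⟩
    rw [← integral_sub_right_eq_self _ (a * i)]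
    simp only [add_sub_cancel]
  rw [Finset.sum_congr rfl fun i hi => by rw [(hshift i hi).2, ← integral_smul],
    ← integral_finsetSum _ (f := fun i y => p i • (gaussKernel (y - a * i) • (B.indicator (fun _ => (1 : ℝ)) y •
      (conditionalMean p S a y - i)))) fun i hi => (hshift i hi).1.smul (p i)]
  refine integral_eq_zero_of_ae (ae_of_all _ fun y => ?_)
  have := sum_weight_mul_conditionalMean_sub hp hne a y
  simp only [smul_comm (gaussKernel _) (B.indicator (fun _ => (1 : ℝ)) y),
    smul_comm (p _) (B.indicator (fun _ => (1 : ℝ)) y), ← Finset.smul_sum, this, smul_zero]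
  rfl

lemma support_nonempty (hS : HasFiniteSupport P x S) : S.Nonempty := by
  obtain ⟨ω, hω⟩ := hS.1.exists
  exact ⟨_, hω⟩

lemma condExp_input_eq_conditionalMean (hx : Measurable x) (hn : Measurable n)
    (hind : IndepFun x n P) (hnoise : P.map n = complexGaussian 0 1)
    (hS : HasFiniteSupport P x S) (a : ℂ) :
    (fun ω => conditionalMean (pmfOf P x) S a (a * x ω + n ω)) =ᵐ[P]
      P[x | MeasurableSpace.comap (fun ω => a * x ω + n ω) inferInstance] := by
  have hne := support_nonempty hS
  have hp : ∀ j ∈ S, 0 < pmfOf P x j := hS.2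
  have hcm := continuous_conditionalMean hp hne a
  have hy : Measurable fun ω => a * x ω + n ω := (hx.const_mul a).add hn
  have hxint : Integrable x P := by
    refine Integrable.of_bound hx.aestronglyMeasurable (∑ j ∈ S, ‖j‖) ?_
    filter_upwards [hS.1] with ω hω
    exact Finset.single_le_sum (f := fun j : ℂ => ‖j‖) (fun _ _ => norm_nonneg _) hω
  have hcint : Integrable (fun ω => conditionalMean (pmfOf P x) S a (a * x ω + n ω)) P :=
    Integrable.of_bound (hcm.measurable.comp hy).aestronglyMeasurable (∑ j ∈ S, ‖j‖)
      (ae_of_all _ fun ω => norm_conditionalMean_le hp a _)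
  refine ae_eq_condExp_of_forall_setIntegral_eq hy.comap_le hxint
    (fun s _ _ => hcint.integrableOn) ?_ ?_
  · rintro s ⟨B, hB, rfl⟩ -
    rw [← sub_eq_zero, ← integral_sub hcint.integrableOn hxint.integrableOn,
      ← integral_indicator (hy hB), ← setIntegral_conditionalMean hx hn hind hnoise hS hne a hB]
    refine integral_congr_ae (ae_of_all _ fun ω => ?_)
    by_cases hω : a * x ω + n ω ∈ B <;> simp [hω]
  · exact (hcm.measurable.comp (comap_measurable _)).stronglyMeasurable.aestronglyMeasurable

theorem mmse_eq_meanSquareError (hx : Measurable x) (hn : Measurable n)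
    (hind : IndepFun x n P) (hnoise : P.map n = complexGaussian 0 1)
    (hS : HasFiniteSupport P x S) (t : ℝ) :
    mmse P x n t = meanSquareError (pmfOf P x) S (√t : ℝ) := by
  have hne := support_nonempty hS
  have hp : ∀ j ∈ S, 0 < pmfOf P x j := hS.2
  have hcm := continuous_conditionalMean hp hne (√t : ℝ)
  have h1 : mmse P x n t = ∫ ω, ‖x ω - conditionalMean (pmfOf P x) S (√t : ℝ)
      ((√t : ℝ) * x ω + n ω)‖ ^ 2 ∂P := by
    unfold mmse canonicalOutput
    refine integral_congr_ae ?_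
    filter_upwards [condExp_input_eq_conditionalMean hx hn hind hnoise hS (√t : ℝ)] with ω hω
    rw [← hω]
  have hcont : Continuous fun q : ℂ × ℂ => ‖q.1 - conditionalMean (pmfOf P x) S (√t : ℝ)
      ((√t : ℝ) * q.1 + q.2)‖ ^ 2 := by fun_prop
  rw [h1, (integral_input_noise hx hn hind hnoise hS (F := fun q => ‖q.1 -
    conditionalMean (pmfOf P x) S (√t : ℝ) ((√t : ℝ) * q.1 + q.2)‖ ^ 2)
    hcont.stronglyMeasurable ?_).2]
  · simp only [sub_conditionalMean hp hne, smul_eq_mul]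
    rfl
  · intro i _
    simp only [smul_eq_mul]
    refine integrable_gaussKernel_mul_of_le (A := (‖i‖ + ∑ j ∈ S, ‖j‖) ^ 2) (B := 0)
      (by fun_prop) fun z => ?_
    rw [abs_of_nonneg (sq_nonneg _), zero_mul, add_zero]
    have := (norm_sub_le i (conditionalMean (pmfOf P x) S (√t : ℝ) ((√t : ℝ) * i + z))).trans
      (add_le_add_right (norm_conditionalMean_le hp _ _) _)
    gcongr

end Laws

/-- Regular conditional laws, given an independent variable, are obtained by substitution. -/
lemma condDistrib_of_indepFun_comp {Ω α β γ : Type*} [MeasurableSpace Ω] [MeasurableSpace α]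
    [MeasurableSpace β] [MeasurableSpace γ] [StandardBorelSpace γ] [Nonempty γ]
    {P : Measure Ω} [IsProbabilityMeasure P] {h : Ω → α} {W : Ω → β} (hh : Measurable h)
    (hW : Measurable W) (hind : IndepFun h W P) {F : α × β → γ} (hF : Measurable F) :
    condDistrib (fun ω => F (h ω, W ω)) h P =ᵐ[P.map h] fun a => P.map (fun ω => F (a, W ω)) := by
  have := Measure.isProbabilityMeasure_map (μ := P) hW.aemeasurable
  have := Measure.isProbabilityMeasure_map (μ := P) hh.aemeasurable
  set κ : Kernel α γ := (Kernel.id ×ₖ Kernel.const α (P.map W)).map F with hκ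
  have hκa : ∀ a, κ a = P.map (fun ω => F (a, W ω)) := by
    intro a
    rw [hκ, Kernel.map_apply _ hF, Kernel.prod_apply, Kernel.id_apply, Kernel.const_apply,
      Measure.dirac_prod, Measure.map_map hF measurable_prodMk_left,
      Measure.map_map (hF.comp measurable_prodMk_left) hW]
    rfl
  have : IsMarkovKernel κ := Kernel.IsMarkovKernel.map _ hF
  have hFhW : Measurable fun ω => F (h ω, W ω) := hF.comp (hh.prodMk hW)
  have key : P.map (fun ω => (h ω, F (h ω, W ω))) = P.map h ⊗ₘ κ := by
    refine Measure.ext_of_lintegral _ fun f hf => ?_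
    have hf2 : Measurable fun q : α × β => f (q.1, F q) := hf.comp (measurable_fst.prodMk hF)
    rw [lintegral_map hf (hh.prodMk hFhW), Measure.lintegral_compProd hf]
    have h1 := lintegral_map (μ := P) hf2 (hh.prodMk hW)
    rw [← h1, (indepFun_iff_map_prod_eq_prod_map_map hh.aemeasurable hW.aemeasurable).1 hind,
      lintegral_prod _ hf2.aemeasurable]
    refine lintegral_congr fun a => ?_
    have hFa : Measurable fun b => F (a, b) := hF.comp measurable_prodMk_left
    rw [hκa, lintegral_map (f := fun b => f (a, b)) (g := fun ω => F (a, W ω))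
        (hf.comp measurable_prodMk_left) (hFa.comp hW),
      lintegral_map (f := fun b => f (a, F (a, b))) (hf2.comp measurable_prodMk_left) hW]
  filter_upwards [condDistrib_ae_eq_of_measure_eq_compProd h hFhW.aemeasurable key] with a ha
  rw [ha, hκa]

/-! ### Mutual information as entropy minus equivocation -/

section Laws

variable {Ω : Type*} [MeasurableSpace Ω] {P : Measure Ω} [IsProbabilityMeasure P]
  {x h n : Ω → ℂ} {S : Finset ℂ}

/-- The density of the joint law of `(x, a x + n)` with respect to the product of its marginals. -/
def informationDensity (p : ℂ → ℝ) (S : Finset ℂ) (a : ℂ) (q : ℂ × ℂ) : ℝ :=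
  Real.exp (-‖q.2 - a * q.1‖ ^ 2) / partition p S (fun j => -j) a q.2

lemma continuous_informationDensity {p : ℂ → ℝ} (hp : ∀ j ∈ S, 0 < p j) (hne : S.Nonempty)
    (a : ℂ) : Continuous (informationDensity p S a) := by
  unfold informationDensity
  exact Continuous.div (by fun_prop) ((continuous_partition a).comp continuous_snd)
    fun q => (partition_pos hp hne a q.2).ne'

/-- Bayes' rule again: the information density is posterior over prior, so its logarithm splits into
an equivocation part and an entropy part. -/
lemma informationDensity_add {p : ℂ → ℝ} (hp : ∀ j ∈ S, 0 < p j) {i : ℂ} (hi : i ∈ S) (a z : ℂ) :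
    informationDensity p S a (i, a * i + z) = posterior p S (fun j => i - j) a i z / p i := by
  have hne := (hp i hi).ne'
  have hU := (partition_pos (d := fun j => i - j) hp ⟨i, hi⟩ a z).ne'
  unfold informationDensity posterior
  simp only [add_sub_cancel_left, sub_self, mul_zero, add_zero, partition_add_mul]
  field_simp

lemma lintegral_input_output (hx : Measurable x) (hn : Measurable n) (hind : IndepFun x n P)
    (hnoise : P.map n = complexGaussian 0 1) (hS : HasFiniteSupport P x S) (a : ℂ)
    {f : ℂ × ℂ → ENNReal} (hf : Measurable f) :
    ∫⁻ ω, f (x ω, a * x ω + n ω) ∂P = ∑ i ∈ S, ENNReal.ofReal (pmfOf P x i) *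
      ∫⁻ y, ENNReal.ofReal (gaussKernel (y - a * i)) * f (i, y) := by
  rw [lintegral_input_noise hx hn hind hnoise hS (f := fun q => f (q.1, a * q.1 + q.2))
    (hf.comp (by fun_prop))]
  refine Finset.sum_congr rfl fun i _ => ?_
  congr 1
  rw [← lintegral_sub_right_eq_self _ (a * i)]
  simp only [add_sub_cancel]

lemma map_output_eq_withDensity (hx : Measurable x) (hn : Measurable n) (hind : IndepFun x n P)
    (hnoise : P.map n = complexGaussian 0 1) (hS : HasFiniteSupport P x S) (a : ℂ) :
    P.map (fun ω => a * x ω + n ω) = volume.withDensity fun y =>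
      ENNReal.ofReal (partition (pmfOf P x) S (fun j => -j) a y / Real.pi) := by
  have hy : Measurable fun ω => a * x ω + n ω := (hx.const_mul a).add hn
  refine Measure.ext_of_lintegral _ fun f hf => ?_
  have hm : Measurable fun y =>
      ENNReal.ofReal (partition (pmfOf P x) S (fun j => -j) a y / Real.pi) :=
    ((continuous_partition a).div_const _).measurable.ennreal_ofReal
  rw [lintegral_map hf hy, lintegral_input_output hx hn hind hnoise hS a
    (f := fun q => f q.2) (hf.comp measurable_snd), lintegral_withDensity_eq_lintegral_mul _ hm hf]
  have hg : ∀ i, Measurable fun y => ENNReal.ofReal (gaussKernel (y - a * i)) * f y := fun i =>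
    (measurable_ofReal_gaussKernel.comp (measurable_id.sub_const _)).mul hf
  rw [Finset.sum_congr rfl fun i _ => (lintegral_const_mul _ (hg i)).symm,
    ← lintegral_finsetSum _ fun i _ => (hg i).const_mul _]
  refine lintegral_congr fun y => ?_
  simp only [Pi.mul_apply, ← mul_assoc, ← Finset.sum_mul]
  congr 1
  unfold partition
  rw [Finset.sum_div, ENNReal.ofReal_sum_of_nonneg
    fun i _ => div_nonneg (mul_nonneg (pmfOf_nonneg i) (Real.exp_pos _).le) Real.pi_pos.le]
  refine Finset.sum_congr rfl fun i _ => ?_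
  rw [← ENNReal.ofReal_mul (pmfOf_nonneg i), gaussKernel, mul_neg, ← sub_eq_add_neg, mul_div_assoc]

lemma map_input_output_eq_withDensity (hx : Measurable x) (hn : Measurable n)
    (hind : IndepFun x n P) (hnoise : P.map n = complexGaussian 0 1)
    (hS : HasFiniteSupport P x S) (a : ℂ) :
    P.map (fun ω => (x ω, a * x ω + n ω)) =
      ((P.map x).prod (P.map fun ω => a * x ω + n ω)).withDensity
        fun q => ENNReal.ofReal (informationDensity (pmfOf P x) S a q) := by
  have hne := support_nonempty hS
  have hp : ∀ j ∈ S, 0 < pmfOf P x j := hS.2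
  have hy : Measurable fun ω => a * x ω + n ω := (hx.const_mul a).add hn
  have := Measure.isProbabilityMeasure_map (μ := P) hy.aemeasurable
  have hg : Measurable fun q => ENNReal.ofReal (informationDensity (pmfOf P x) S a q) :=
    (continuous_informationDensity hp hne a).measurable.ennreal_ofReal
  have hm : Measurable fun y =>
      ENNReal.ofReal (partition (pmfOf P x) S (fun j => -j) a y / Real.pi) :=
    ((continuous_partition a).div_const _).measurable.ennreal_ofReal
  refine Measure.ext_of_lintegral _ fun f hf => ?_
  rw [lintegral_map hf (hx.prodMk hy), lintegral_input_output hx hn hind hnoise hS a hf,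
    lintegral_withDensity_eq_lintegral_mul _ hg hf, lintegral_prod _ (hg.mul hf).aemeasurable,
    lintegral_input hx hS]
  refine Finset.sum_congr rfl fun i _ => ?_
  congr 1
  rw [map_output_eq_withDensity hx hn hind hnoise hS,
    lintegral_withDensity_eq_lintegral_mul _ hm (g := fun y =>
      ((fun q => ENNReal.ofReal (informationDensity (pmfOf P x) S a q)) * f) (i, y))
      ((hg.mul hf).comp measurable_prodMk_left)]
  refine lintegral_congr fun y => ?_
  have hU := partition_pos (d := fun j => -j) hp hne a y
  simp only [Pi.mul_apply, ← mul_assoc]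
  rw [← ENNReal.ofReal_mul (div_pos hU Real.pi_pos).le]
  congr 2
  unfold informationDensity gaussKernel
  have := hU.ne'
  field_simp

/-- The mutual information across the channel of constant gain `a` is the entropy of the input
minus its equivocation. -/
theorem mutualInfoOfLaws_eq (hx : Measurable x) (hn : Measurable n)
    (hind : IndepFun x n P) (hnoise : P.map n = complexGaussian 0 1)
    (hS : HasFiniteSupport P x S) (a : ℂ) :
    mutualInfoOfLaws (P.map fun ω => (x ω, a * x ω + n ω)) (P.map x)
      (P.map fun ω => a * x ω + n ω) = entropy P x S - equivocation (pmfOf P x) S a := by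
  have hne := support_nonempty hS
  have hp : ∀ j ∈ S, 0 < pmfOf P x j := hS.2
  have hy : Measurable fun ω => a * x ω + n ω := (hx.const_mul a).add hn
  have := Measure.isProbabilityMeasure_map (μ := P) hy.aemeasurable
  have := Measure.isProbabilityMeasure_map (μ := P) hx.aemeasurable
  have hgc := continuous_informationDensity hp hne a
  have hg : Measurable fun q => ENNReal.ofReal (informationDensity (pmfOf P x) S a q) :=
    hgc.measurable.ennreal_ofReal
  have hgpos : ∀ q, 0 < informationDensity (pmfOf P x) S a q := fun q =>
    div_pos (Real.exp_pos _) (partition_pos hp hne a q.2)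
  have hlog : Continuous fun q => Real.log (informationDensity (pmfOf P x) S a q) :=
    hgc.log fun q => (hgpos q).ne'
  unfold mutualInfoOfLaws
  have hjoint := map_input_output_eq_withDensity hx hn hind hnoise hS a
  have h1 : ∀ᵐ q ∂(P.map fun ω => (x ω, a * x ω + n ω)),
      llr (P.map fun ω => (x ω, a * x ω + n ω))
        ((P.map x).prod (P.map fun ω => a * x ω + n ω)) q =
      Real.log (informationDensity (pmfOf P x) S a q) := by
    rw [hjoint]
    -- The density is identified almost everywhere for the product of the marginals; absolute
    -- continuity transfers this to the joint law.
    refine (withDensity_absolutelyContinuous _ _).ae_le ?_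
    filter_upwards [Measure.rnDeriv_withDensity
      ((P.map x).prod (P.map fun ω => a * x ω + n ω)) hg] with q hq
    rw [llr, hq, ENNReal.toReal_ofReal (hgpos q).le]
  rw [integral_congr_ae h1, integral_map (hx.prodMk hy).aemeasurable hlog.aestronglyMeasurable]
  have hval : ∀ i ∈ S, ∀ z, gaussKernel z •
      Real.log (informationDensity (pmfOf P x) S a (i, a * i + z)) =
      -(gaussKernel z * -Real.log (posterior (pmfOf P x) S (fun j => i - j) a i z)) -
        gaussKernel z * Real.log (pmfOf P x i) := by
    intro i hi z
    rw [informationDensity_add hp hi, Real.log_div (posterior_pos hp a hi z).ne' (hp i hi).ne',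
      smul_eq_mul]
    ring
  have hI : ∀ i ∈ S, Integrable fun z =>
      gaussKernel z * -Real.log (posterior (pmfOf P x) S (fun j => i - j) a i z) := fun i hi =>
    integrable_neg_log_posterior (d := fun j => i - j) hp hi (sub_self i) a
  rw [(integral_input_noise hx hn hind hnoise hS
    (F := fun q => Real.log (informationDensity (pmfOf P x) S a (q.1, a * q.1 + q.2)))
    (hlog.comp (by fun_prop : Continuous fun q : ℂ × ℂ => (q.1, a * q.1 + q.2))).stronglyMeasurable
    ?_).2]
  · unfold entropy equivocation
    rw [← Finset.sum_neg_distrib, ← Finset.sum_sub_distrib]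
    refine Finset.sum_congr rfl fun i hi => ?_
    rw [integral_congr_ae (ae_of_all _ (hval i hi)),
      integral_sub (hI i hi).fun_neg (integrable_gaussKernel.mul_const _), integral_neg,
      integral_mul_const, integral_gaussKernel, smul_eq_mul, pmfOf]
    ring
  · intro i hi
    refine Integrable.congr ?_ (ae_of_all _ fun z => (hval i hi z).symm)
    exact (hI i hi).fun_neg.sub (integrable_gaussKernel.mul_const _)

/-- Since h is independent of (x, n), conditioning on h = h₀ amounts to substituting h₀. The
equality is only almost sure because regular conditional laws are. -/
theorem condMutualInfo_ae_eq (hx : Measurable x) (hh : Measurable h) (hn : Measurable n)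
    (hindep : iIndepFun ![x, h, n] P) (hnoise : P.map n = complexGaussian 0 1)
    (hS : HasFiniteSupport P x S) (snr : ℝ) :
    ∀ᵐ h₀ ∂(P.map h), condMutualInfo P x h n snr h₀ =
      entropy P x S - equivocation (pmfOf P x) S (√snr * h₀) := by
  have hmeas : ∀ i, Measurable (![x, h, n] i) := by
    intro i; fin_cases i <;> simpa
  have hxn : IndepFun x n P := hindep.indepFun (i := 0) (j := 2) (by decide)
  have hW : IndepFun h (fun ω => (x ω, n ω)) P :=
    (hindep.indepFun_prodMk hmeas 0 2 1 (by decide) (by decide)).symm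
  have hWm : Measurable fun ω => (x ω, n ω) := hx.prodMk hn
  have h1 := condDistrib_of_indepFun_comp hh hWm hW
    (F := fun q : ℂ × ℂ × ℂ => (q.2.1, (√snr : ℂ) * q.1 * q.2.1 + q.2.2)) (by fun_prop)
  have h2 := condDistrib_of_indepFun_comp hh hWm hW
    (F := fun q : ℂ × ℂ × ℂ => q.2.1) (by fun_prop)
  have h3 := condDistrib_of_indepFun_comp hh hWm hW
    (F := fun q : ℂ × ℂ × ℂ => (√snr : ℂ) * q.1 * q.2.1 + q.2.2) (by fun_prop)
  filter_upwards [h1, h2, h3] with h₀ e1 e2 e3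
  rw [← mutualInfoOfLaws_eq hx hn hxn hnoise hS]
  unfold condMutualInfo output
  rw [← e1, ← e2, ← e3]

/-- The loss `H(x | √t x + n)` of mutual information at signal-to-noise ratio `t`. -/
def informationGap (p : ℂ → ℝ) (S : Finset ℂ) (t : ℝ) : ℝ := equivocation p S (√t : ℝ)

section Gap

variable {p : ℂ → ℝ}

lemma continuous_informationGap (hp : ∀ j ∈ S, 0 < p j) (hsum : ∑ j ∈ S, p j = 1) :
    Continuous (informationGap p S) := by
  have h : Continuous fun s : ℝ => equivocation p S s :=
    continuous_iff_continuousAt.2 fun s => (hasDerivAt_equivocation hp hsum s).continuousAt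
  exact h.comp Real.continuous_sqrt

lemma informationGap_nonneg (hp : ∀ j ∈ S, 0 < p j) (t : ℝ) : 0 ≤ informationGap p S t :=
  equivocation_nonneg hp _

/-- The factor 2√t from differentiating in the amplitude cancels the derivative 1/(2√t) of the
square root, which exists only for t > 0. -/
lemma hasDerivAt_informationGap (hp : ∀ j ∈ S, 0 < p j) (hsum : ∑ j ∈ S, p j = 1) {t : ℝ}
    (ht : 0 < t) :
    HasDerivAt (informationGap p S) (-meanSquareError p S (√t : ℝ)) t := by
  have h := (hasDerivAt_equivocation hp hsum √t).comp t (Real.hasDerivAt_sqrt ht.ne')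
  refine h.congr_deriv ?_
  have := (Real.sqrt_pos.2 ht).ne'
  field_simp

lemma equivocation_eq_informationGap (snr : ℝ) (hsnr : 0 ≤ snr) (h₀ : ℂ) :
    equivocation p S (√snr * h₀) = informationGap p S (snr * ‖h₀‖ ^ 2) := by
  rw [equivocation_eq_norm, informationGap, norm_mul, Complex.norm_real,
    Real.norm_of_nonneg (Real.sqrt_nonneg _), Real.sqrt_mul hsnr, Real.sqrt_sq (norm_nonneg _)]

lemma exists_informationGap_bound (hp : ∀ j ∈ S, 0 < p j) :
    ∃ K c : ℝ, 0 ≤ K ∧ 0 < c ∧ ∀ t : ℝ, 0 ≤ t → informationGap p S t ≤ K * Real.exp (-(c * t)) ∧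
      meanSquareError p S (√t : ℝ) ≤ K * Real.exp (-(c * t)) := by
  obtain ⟨K, c, hK, hc, h⟩ := exists_mul_exp_bound hp
  refine ⟨K, c, hK, hc, fun t ht => ?_⟩
  have := h (√t : ℝ)
  rwa [Complex.norm_real, Real.norm_of_nonneg (Real.sqrt_nonneg _), Real.sq_sqrt ht] at this

end Gap

theorem entropy_sub_avgMutualInfo (hx : Measurable x) (hh : Measurable h) (hn : Measurable n)
    (hindep : iIndepFun ![x, h, n] P) (hnoise : P.map n = complexGaussian 0 1)
    (hS : HasFiniteSupport P x S) {snr : ℝ} (hsnr : 0 ≤ snr) :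
    entropy P x S - avgMutualInfo P x h n snr =
      ∫ r, informationGap (pmfOf P x) S (snr * r ^ 2) ∂(P.map fun ω => ‖h ω‖) := by
  have hp : ∀ j ∈ S, 0 < pmfOf P x j := hS.2
  have hsum := sum_pmfOf hx hS
  have hc := continuous_informationGap hp hsum
  have := Measure.isProbabilityMeasure_map (μ := P) hh.aemeasurable
  obtain ⟨K, c, hK, hc0, hb⟩ := exists_informationGap_bound hp
  have hI : Integrable (fun h₀ : ℂ => informationGap (pmfOf P x) S (snr * ‖h₀‖ ^ 2))
      (P.map h) := by
    refine Integrable.of_bound (by fun_prop) K (ae_of_all _ fun h₀ => ?_)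
    rw [Real.norm_of_nonneg (informationGap_nonneg hp _)]
    refine (hb _ (by positivity)).1.trans (mul_le_of_le_one_right hK ?_)
    rw [Real.exp_le_one_iff]
    have : 0 ≤ c * (snr * ‖h₀‖ ^ 2) := by positivity
    linarith
  unfold avgMutualInfo
  rw [integral_congr_ae (condMutualInfo_ae_eq hx hh hn hindep hnoise hS snr)]
  simp only [equivocation_eq_informationGap snr hsnr]
  rw [integral_sub (integrable_const _) hI, integral_const, probReal_univ, one_smul,
    sub_sub_cancel, integral_map hh.aemeasurable (by fun_prop),
    integral_map hh.norm.aemeasurable (by fun_prop)]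

end Laws

/-! ### Mellin integrals of exponentially decaying functions -/

section Mellin

variable {g m : ℝ → ℝ} {K c : ℝ}

lemma integrableOn_rpow_mul_exp_neg_mul {b : ℝ} (hb : 0 < b) (hc : 0 < c) (K : ℝ) :
    IntegrableOn (fun t : ℝ => t ^ (b - 1) * (K * Real.exp (-(c * t)))) (Set.Ioi 0) := by
  have := (integrableOn_rpow_mul_exp_neg_mul_rpow (p := 1) (s := b - 1) (by linarith) one_pos
    hc).const_mul K
  refine IntegrableOn.congr_fun this (fun t _ => ?_) measurableSet_Ioi
  simp only [Real.rpow_one, neg_mul]; ring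

lemma integrableOn_rpow_mul_of_le_exp (hgm : AEStronglyMeasurable g (volume.restrict (Set.Ioi 0)))
    (hc : 0 < c) (hg : ∀ t, 0 < t → |g t| ≤ K * Real.exp (-(c * t))) {b : ℝ} (hb : 0 < b) :
    IntegrableOn (fun t : ℝ => t ^ (b - 1) * g t) (Set.Ioi 0) := by
  refine (integrableOn_rpow_mul_exp_neg_mul hb hc K).mono' ?_ ?_
  · exact (by fun_prop : Measurable fun t : ℝ => t ^ (b - 1)).aestronglyMeasurable.mul hgm
  · filter_upwards [ae_restrict_mem measurableSet_Ioi] with t ht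
    rw [norm_mul, Real.norm_of_nonneg (Real.rpow_nonneg (le_of_lt ht) _), Real.norm_eq_abs]
    exact mul_le_mul_of_nonneg_left (hg t ht) (Real.rpow_nonneg (le_of_lt ht) _)

/-- Provides the measurability of mmse as a derivative, without any direct study of its dependence
on t. -/
lemma aestronglyMeasurable_of_hasDerivAt_neg (hder : ∀ t, 0 < t → HasDerivAt g (-m t) t) :
    AEStronglyMeasurable m (volume.restrict (Set.Ioi 0)) := by
  refine (measurable_deriv g).neg.aestronglyMeasurable.congr ?_
  filter_upwards [ae_restrict_mem measurableSet_Ioi] with t ht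
  simp [(hder t ht).deriv]

/-- Integration by parts in a Mellin transform. -/
lemma integral_rpow_mul_eq_of_hasDerivAt_neg (hgc : Continuous g) (hc : 0 < c)
    (hg : ∀ t, 0 < t → |g t| ≤ K * Real.exp (-(c * t)))
    (hm : ∀ t, 0 < t → |m t| ≤ K * Real.exp (-(c * t)))
    (hder : ∀ t, 0 < t → HasDerivAt g (-m t) t) {b : ℝ} (hb : 0 < b) :
    ∫ t in Set.Ioi (0 : ℝ), t ^ (b - 1) * g t = 1 / b * ∫ t in Set.Ioi (0 : ℝ), t ^ b * m t := by
  have hmI : IntegrableOn (fun t : ℝ => t ^ b * m t) (Set.Ioi 0) := by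
    simpa using integrableOn_rpow_mul_of_le_exp (b := b + 1)
      (aestronglyMeasurable_of_hasDerivAt_neg hder) hc hm (by linarith)
  have hgI := integrableOn_rpow_mul_of_le_exp hgc.aestronglyMeasurable.restrict hc hg hb
  have h := integral_Ioi_mul_deriv_eq_deriv_mul (a := 0) (a' := 0) (b' := 0)
    (u := fun t : ℝ => t ^ b) (v := g) (u' := fun t => b * t ^ (b - 1)) (v' := fun t => -m t)
    (fun t ht => Real.hasDerivAt_rpow_const (Or.inl (ne_of_gt ht))) (fun t ht => hder t ht)
    (IntegrableOn.congr_fun hmI.neg (fun t _ => by simp) measurableSet_Ioi)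
    (IntegrableOn.congr_fun (hgI.const_mul b) (fun t _ => by simp [mul_assoc]) measurableSet_Ioi)
    ?_ ?_
  · simp only [mul_neg, integral_neg, mul_assoc, integral_const_mul, sub_self, zero_sub,
      neg_inj] at h
    rw [h]; field_simp
  -- Boundary terms: at 0 the power kills the continuous g because b > 0; at infinity the
  -- exponential decay wins.
  · have : Tendsto (fun t : ℝ => t ^ b * g t) (nhds 0) (nhds ((0 : ℝ) ^ b * g 0)) :=
      ((Real.continuousAt_rpow_const 0 b (Or.inr hb.le)).mul hgc.continuousAt)
    rw [Real.zero_rpow hb.ne', zero_mul] at this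
    exact this.mono_left nhdsWithin_le_nhds
  · have h1 := (tendsto_rpow_mul_exp_neg_mul_atTop_nhds_zero b c hc).const_mul K
    rw [mul_zero] at h1
    refine squeeze_zero_norm' ?_ h1
    filter_upwards [eventually_gt_atTop 0] with t ht
    rw [Pi.mul_apply, norm_mul, Real.norm_of_nonneg (Real.rpow_nonneg ht.le _), Real.norm_eq_abs]
    have := mul_le_mul_of_nonneg_left (hg t ht) (Real.rpow_nonneg ht.le b)
    rw [neg_mul]
    linarith

lemma integral_rpow_mul_comp_mul (b : ℝ) {s : ℝ} (hs : 0 < s) :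
    ∫ v in Set.Ioi (0 : ℝ), v ^ (b - 1) * g (s * v) =
      s ^ (-b) * ∫ v in Set.Ioi (0 : ℝ), v ^ (b - 1) * g v := by
  have h := integral_comp_mul_left_Ioi (fun v => v ^ (b - 1) * g v) 0 hs
  rw [mul_zero] at h
  have h2 : ∫ v in Set.Ioi (0 : ℝ), (s * v) ^ (b - 1) * g (s * v) =
      s ^ (b - 1) * ∫ v in Set.Ioi (0 : ℝ), v ^ (b - 1) * g (s * v) := by
    rw [← integral_const_mul]
    refine setIntegral_congr_fun measurableSet_Ioi fun v hv => ?_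
    simp only [Real.mul_rpow hs.le (le_of_lt hv), mul_assoc]
  rw [h2, smul_eq_mul] at h
  have hpos : 0 < s ^ (b - 1) := Real.rpow_pos_of_pos hs _
  have hsb : s ^ (-b) = (s ^ (b - 1))⁻¹ * s⁻¹ := by
    rw [← Real.rpow_neg hs.le, ← Real.rpow_neg_one s, ← Real.rpow_add hs]; ring_nf
  rw [hsb, mul_assoc, ← h, ← mul_assoc, inv_mul_cancel₀ hpos.ne', one_mul]

end Mellin

/-! ### Global Taylor estimates -/

section Taylor

/-- A bounded entire series on the positive half-line obeys global Taylor estimates. -/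
lemma exists_abs_sub_sum_le {a : ℕ → ℝ} {q : ℝ → ℝ} (hq : ∀ v, HasSum (fun k => a k * v ^ k) (q v))
    {B : ℝ} (hB : ∀ v, 0 < v → |q v| ≤ B) (N : ℕ) :
    ∃ C, ∀ v, 0 < v → |q v - ∑ k ∈ Finset.range N, a k * v ^ k| ≤ C * v ^ N := by
  have hsum : Summable fun k => |a k| := by simpa using (hq 1).summable.abs
  have hsumN : Summable fun k => |a (k + N)| := (summable_nat_add_iff N).2 hsum
  refine ⟨∑' k, |a (k + N)| + (B + ∑ k ∈ Finset.range N, |a k|), fun v hv => ?_⟩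
  have hB0 : 0 ≤ B := (abs_nonneg _).trans (hB v hv)
  have hT0 : 0 ≤ ∑' k, |a (k + N)| := tsum_nonneg fun _ => abs_nonneg _
  have hS0 : 0 ≤ ∑ k ∈ Finset.range N, |a k| := Finset.sum_nonneg fun _ _ => abs_nonneg _
  -- For v ≤ 1 the tail of the series carries a factor v^N. For v ≥ 1, both q and its Taylor
  -- polynomial are at most a constant times v^N.
  rcases le_total v 1 with h1 | h1
  · have h2 : q v - ∑ k ∈ Finset.range N, a k * v ^ k = ∑' k, a (k + N) * v ^ (k + N) := by
      rw [← (hq v).tsum_eq, ← (hq v).summable.sum_add_tsum_nat_add N, add_sub_cancel_left]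
    have h3 : ∀ k, ‖a (k + N) * v ^ (k + N)‖ ≤ |a (k + N)| * v ^ N := fun k => by
      rw [norm_mul, Real.norm_eq_abs, norm_pow, Real.norm_of_nonneg hv.le, pow_add]
      refine mul_le_mul_of_nonneg_left ?_ (abs_nonneg _)
      exact mul_le_of_le_one_left (by positivity) (pow_le_one₀ hv.le h1)
    have h4 := tsum_of_norm_bounded (hsumN.mul_right (v ^ N)).hasSum h3
    rw [h2, ← Real.norm_eq_abs]
    refine h4.trans ?_
    rw [tsum_mul_right]
    gcongr
    linarith
  · have hvN : 1 ≤ v ^ N := one_le_pow₀ h1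
    have h2 : |∑ k ∈ Finset.range N, a k * v ^ k| ≤ (∑ k ∈ Finset.range N, |a k|) * v ^ N := by
      rw [Finset.sum_mul]
      refine (Finset.abs_sum_le_sum_abs _ _).trans (Finset.sum_le_sum fun k hk => ?_)
      rw [abs_mul, abs_of_nonneg (pow_nonneg hv.le k)]
      exact mul_le_mul_of_nonneg_left (pow_le_pow_right₀ h1 (Finset.mem_range.1 hk).le)
        (abs_nonneg _)
    calc |q v - ∑ k ∈ Finset.range N, a k * v ^ k|
        ≤ |q v| + |∑ k ∈ Finset.range N, a k * v ^ k| := abs_sub _ _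
      _ ≤ B * v ^ N + (∑ k ∈ Finset.range N, |a k|) * v ^ N :=
        add_le_add ((hB v hv).trans (le_mul_of_one_le_right hB0 hvN)) h2
      _ ≤ _ := by nlinarith [mul_nonneg hT0 (zero_le_one.trans hvN)]

lemma measurable_of_hasSum_pow {a : ℕ → ℝ} {q : ℝ → ℝ}
    (hq : ∀ v, HasSum (fun k => a k * v ^ k) (q v)) : Measurable q :=
  measurable_of_tendsto_metrizable (f := fun n v => ∑ k ∈ Finset.range n, a k * v ^ k)
    (fun n => by fun_prop) (tendsto_pi_nhds.2 fun v => (hq v).tendsto_sum_nat)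

end Taylor

/-! ### A Watson-type expansion -/

section Expansion

lemma isLittleO_rpow_neg_of_lt {a b : ℝ} (h : b < a) :
    (fun t : ℝ => t ^ (-a)) =o[atTop] fun t : ℝ => t ^ (-b) := by
  refine (isLittleO_iff_tendsto' ?_).2 ?_
  · filter_upwards [eventually_gt_atTop 0] with t ht h0
    exact absurd h0 (Real.rpow_pos_of_pos ht _).ne'
  · refine (tendsto_rpow_neg_atTop (sub_pos.2 h)).congr' ?_
    filter_upwards [eventually_gt_atTop 0] with t ht
    rw [← Real.rpow_sub ht]; ring_nf

/-- A Watson-type lemma: the power series of the density of the squared modulus yields the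
expansion of the averaged function at infinity. -/
theorem isBigO_integral_sub_sum {g : ℝ → ℝ} {K c : ℝ} (hgc : Continuous g) (hc : 0 < c)
    (hg : ∀ t, 0 < t → |g t| ≤ K * Real.exp (-(c * t))) {a : ℕ → ℝ} {q : ℝ → ℝ}
    (hq : ∀ v, HasSum (fun k => a k * v ^ k) (q v)) {B : ℝ} (hB : ∀ v, 0 < v → |q v| ≤ B)
    {α : ℝ} (hα : 0 < α) (N : ℕ) :
    (fun s => (∫ v in Set.Ioi (0 : ℝ), v ^ (α - 1) * (q v * g (s * v))) -
      ∑ k ∈ Finset.range N, a k *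
        (∫ v in Set.Ioi (0 : ℝ), v ^ (α + k - 1) * g v) * s ^ (-(α + k))) =O[atTop]
      fun s => s ^ (-(α + N)) := by
  obtain ⟨C, hC⟩ := exists_abs_sub_sum_le hq hB N
  refine IsBigO.of_bound (C * ∫ v in Set.Ioi (0 : ℝ), v ^ (α + N - 1) * |g v|) ?_
  filter_upwards [eventually_gt_atTop 0] with s hs
  have hgs : ∀ v, 0 < v → |g (s * v)| ≤ K * Real.exp (-(c * s * v)) := fun v hv => by
    simpa only [mul_assoc] using hg (s * v) (mul_pos hs hv)
  have hgsc : Continuous fun v => g (s * v) := by fun_prop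
  have hcs := mul_pos hc hs
  have hpow : ∀ (k : ℕ) (v : ℝ), 0 < v → v ^ (α + k - 1) = v ^ (α - 1) * v ^ k := fun k v hv => by
    rw [← Real.rpow_natCast, ← Real.rpow_add hv]; ring_nf
  have hI1 : IntegrableOn (fun v : ℝ => v ^ (α - 1) * (q v * g (s * v))) (Set.Ioi 0) := by
    refine integrableOn_rpow_mul_of_le_exp (g := fun v => q v * g (s * v)) (K := B * K)
      ((measurable_of_hasSum_pow hq).mul hgsc.measurable).aestronglyMeasurable hcs
      (fun v hv => ?_) hα
    rw [abs_mul, mul_assoc]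
    exact mul_le_mul (hB v hv) (hgs v hv) (abs_nonneg _) ((abs_nonneg _).trans (hB v hv))
  have hI2 : ∀ k : ℕ, IntegrableOn (fun v : ℝ => a k * (v ^ (α + k - 1) * g (s * v)))
      (Set.Ioi 0) := fun k =>
    (integrableOn_rpow_mul_of_le_exp hgsc.aestronglyMeasurable.restrict hcs hgs
      (by positivity)).const_mul _
  have hI3 : IntegrableOn (fun v : ℝ => C * (v ^ (α + N - 1) * |g (s * v)|)) (Set.Ioi 0) :=
    (integrableOn_rpow_mul_of_le_exp (g := fun v => |g (s * v)|)
      hgsc.abs.aestronglyMeasurable.restrict hcs (fun v hv => by rw [abs_abs]; exact hgs v hv)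
      (by positivity)).const_mul _
  have hterm : ∀ k : ℕ, a k * (∫ v in Set.Ioi (0 : ℝ), v ^ (α + k - 1) * g v) * s ^ (-(α + k)) =
      ∫ v in Set.Ioi (0 : ℝ), a k * (v ^ (α + k - 1) * g (s * v)) := fun k => by
    rw [integral_const_mul, integral_rpow_mul_comp_mul _ hs]; ring
  have hlast : C * (∫ v in Set.Ioi (0 : ℝ), v ^ (α + N - 1) * |g v|) * s ^ (-(α + N)) =
      ∫ v in Set.Ioi (0 : ℝ), C * (v ^ (α + N - 1) * |g (s * v)|) := by
    rw [integral_const_mul, integral_rpow_mul_comp_mul (g := fun v => |g v|) _ hs]; ring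
  rw [Real.norm_of_nonneg (Real.rpow_nonneg hs.le _), hlast,
    Finset.sum_congr rfl fun k _ => hterm k, ← integral_finsetSum _ fun k _ => hI2 k,
    ← integral_sub hI1 (integrable_finsetSum _ fun k _ => hI2 k)]
  refine norm_integral_le_of_norm_le hI3 ?_
  filter_upwards [ae_restrict_mem measurableSet_Ioi] with v hv
  have hv0 : 0 < v := hv
  have heq : v ^ (α - 1) * (q v * g (s * v)) -
      ∑ k ∈ Finset.range N, a k * (v ^ (α + k - 1) * g (s * v)) =
      v ^ (α - 1) * ((q v - ∑ k ∈ Finset.range N, a k * v ^ k) * g (s * v)) := by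
    rw [sub_mul, mul_sub, Finset.sum_mul, Finset.mul_sum]
    congr 1
    refine Finset.sum_congr rfl fun k _ => ?_
    rw [hpow k v hv0]; ring
  rw [heq, norm_mul, norm_mul, Real.norm_of_nonneg (Real.rpow_nonneg hv0.le _), Real.norm_eq_abs,
    Real.norm_eq_abs, hpow N v hv0]
  calc v ^ (α - 1) * (|q v - ∑ k ∈ Finset.range N, a k * v ^ k| * |g (s * v)|)
      ≤ v ^ (α - 1) * (C * v ^ N * |g (s * v)|) := by gcongr; exact hC v hv0
    _ = _ := by ring

end Expansion

/-- The substitution v = r² turns the density of the modulus into the density v^(α-1) q(v) of its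
square. -/
lemma integral_modulus_density {f q : ℝ → ℝ} {α : ℝ} (hq : Measurable q)
    (hq0 : ∀ v, 0 < v → 0 ≤ q v) (hf : ∀ r, 0 < r → f r = 2 * r ^ (2 * α - 1) * q (r ^ 2))
    (G : ℝ → ℝ) :
    ∫ r, G (r ^ 2) ∂((volume.restrict (Set.Ioi 0)).withDensity fun r => ENNReal.ofReal (f r)) =
      ∫ v in Set.Ioi (0 : ℝ), v ^ (α - 1) * (q v * G v) := by
  have h1 : (volume.restrict (Set.Ioi (0 : ℝ))).withDensity (fun r => ENNReal.ofReal (f r)) =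
      (volume.restrict (Set.Ioi (0 : ℝ))).withDensity
        fun r => ENNReal.ofReal (2 * r ^ (2 * α - 1) * q (r ^ 2)) := by
    refine withDensity_congr_ae ?_
    filter_upwards [ae_restrict_mem measurableSet_Ioi] with r hr
    rw [hf r hr]
  rw [h1, integral_withDensity_eq_integral_toReal_smul (by fun_prop)
    (ae_of_all _ fun _ => ENNReal.ofReal_lt_top),
    ← integral_comp_rpow_Ioi_of_pos (g := fun v => v ^ (α - 1) * (q v * G v)) two_pos]
  refine setIntegral_congr_fun measurableSet_Ioi fun r hr => ?_
  have hr0 : 0 < r := hr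
  have h2 : r ^ (2 * α - 1) = r * r ^ (2 * (α - 1)) := by
    rw [show 2 * α - 1 = 1 + 2 * (α - 1) by ring, Real.rpow_add hr0, Real.rpow_one]
  have h3 : (2 : ℝ) - 1 = 1 := by norm_num
  simp only [Real.rpow_two, smul_eq_mul]
  rw [ENNReal.toReal_ofReal (mul_nonneg (by positivity) (hq0 _ (by positivity))), h2, h3,
    Real.rpow_one, ← Real.rpow_natCast r 2, ← Real.rpow_mul hr0.le]
  push_cast
  ring

/-! ### The expansion for a general fading law -/

section Channel

variable {Ω : Type*} [MeasurableSpace Ω] {P : Measure Ω} [IsProbabilityMeasure P]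
  {x h n : Ω → ℂ} {S : Finset ℂ}

/-- Integration by parts trades the moment of order b of the gap for the Mellin transform of its
negative derivative, mmse, at 1 + b. -/
lemma mellin_mmseC (hx : Measurable x) (hn : Measurable n) (hind : IndepFun x n P)
    (hnoise : P.map n = complexGaussian 0 1) (hS : HasFiniteSupport P x S) {b : ℝ} (hb : 0 < b) :
    MellinConvergent (mmseC P x n) (1 + b) ∧
    mellin (mmseC P x n) (1 + b) =
      ((b * ∫ t in Set.Ioi (0 : ℝ), t ^ (b - 1) * informationGap (pmfOf P x) S t : ℝ) : ℂ) := by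
  have hp : ∀ j ∈ S, 0 < pmfOf P x j := hS.2
  have hsum := sum_pmfOf hx hS
  obtain ⟨K, c, hK, hc, hbd⟩ := exists_informationGap_bound hp
  have hg : ∀ t, 0 < t → |informationGap (pmfOf P x) S t| ≤ K * Real.exp (-(c * t)) :=
    fun t ht => by
      rw [abs_of_nonneg (informationGap_nonneg hp t)]; exact (hbd t ht.le).1
  have hm : ∀ t, 0 < t → |meanSquareError (pmfOf P x) S (√t : ℝ)| ≤ K * Real.exp (-(c * t)) :=
    fun t ht => by
      rw [abs_of_nonneg (meanSquareError_nonneg hp _)]; exact (hbd t ht.le).2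
  have hder : ∀ t, 0 < t → HasDerivAt (informationGap (pmfOf P x) S)
      (-meanSquareError (pmfOf P x) S (√t : ℝ)) t := fun t ht =>
    hasDerivAt_informationGap hp hsum ht
  have hI : IntegrableOn (fun t : ℝ => t ^ b * meanSquareError (pmfOf P x) S (√t : ℝ))
      (Set.Ioi 0) := by
    simpa using integrableOn_rpow_mul_of_le_exp (b := b + 1)
      (aestronglyMeasurable_of_hasDerivAt_neg hder) hc hm (by linarith)
  have hcongr : ∀ t ∈ Set.Ioi (0 : ℝ), (t : ℂ) ^ ((1 + b : ℂ) - 1) • mmseC P x n t =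
      ((t ^ b * meanSquareError (pmfOf P x) S (√t : ℝ) : ℝ) : ℂ) := fun t ht => by
    rw [mmseC, mmse_eq_meanSquareError hx hn hind hnoise hS, add_sub_cancel_left, smul_eq_mul,
      Complex.ofReal_mul, Complex.ofReal_cpow (le_of_lt ht)]
  refine ⟨IntegrableOn.congr_fun (Integrable.ofReal hI) (fun t ht => (hcongr t ht).symm)
    measurableSet_Ioi, ?_⟩
  rw [mellin, setIntegral_congr_fun measurableSet_Ioi hcongr, integral_complex_ofReal,
    integral_rpow_mul_eq_of_hasDerivAt_neg (continuous_informationGap hp hsum) hc hg hm hder hb,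
    ← mul_assoc, mul_one_div_cancel hb.ne', one_mul]

/-- The high-SNR expansion of the average mutual information for a fading law whose squared
modulus has density `v ^ (α - 1) q(v)`, with `q` a bounded entire power series. -/
theorem hasAsymptoticExpansion_of_modulusHasDensity (hx : Measurable x) (hh : Measurable h)
    (hn : Measurable n) (hindep : iIndepFun ![x, h, n] P)
    (hnoise : P.map n = complexGaussian 0 1) (hS : HasFiniteSupport P x S)
    {f : ℝ → ℝ} (hden : ModulusHasDensity P h f) {a : ℕ → ℝ} {q : ℝ → ℝ} {B α : ℝ} (hα : 0 < α)
    (hq : ∀ v, HasSum (fun k => a k * v ^ k) (q v)) (hq0 : ∀ v, 0 < v → 0 ≤ q v)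
    (hB : ∀ v, 0 < v → q v ≤ B)
    (hf : ∀ r, 0 < r → f r = 2 * r ^ (2 * α - 1) * q (r ^ 2)) :
    (∀ k : ℕ, MellinConvergent (mmseC P x n) (1 + α + k)) ∧
    HasAsymptoticExpansion
      (fun snr => ((entropy P x S - avgMutualInfo P x h n snr : ℝ) : ℂ))
      (fun k => ((a k / (α + k) : ℝ) : ℂ) * mellin (mmseC P x n) (1 + α + k))
      (fun k snr => snr ^ (-(α + k : ℝ))) := by
  have hp : ∀ j ∈ S, 0 < pmfOf P x j := hS.2
  have hsum := sum_pmfOf hx hS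
  have hind : IndepFun x n P := hindep.indepFun (i := 0) (j := 2) (by decide)
  obtain ⟨K, c, hK, hc, hbd⟩ := exists_informationGap_bound hp
  have hg : ∀ t, 0 < t → |informationGap (pmfOf P x) S t| ≤ K * Real.exp (-(c * t)) :=
    fun t ht => by
      rw [abs_of_nonneg (informationGap_nonneg hp t)]; exact (hbd t ht.le).1
  have hcast : ∀ k : ℕ, (1 + α + k : ℂ) = 1 + ((α + k : ℝ) : ℂ) := fun k => by
    push_cast; ring
  have hmel := fun k : ℕ => mellin_mmseC hx hn hind hnoise hS (b := α + k) (by positivity)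
  refine ⟨fun k => by rw [hcast]; exact (hmel k).1, fun k => ?_, fun k => ?_, fun N => ?_⟩
  · exact continuousOn_id.rpow_const fun t ht => Or.inl (ne_of_gt ht)
  · exact isLittleO_rpow_neg_of_lt (by push_cast; linarith)
  · have key := isBigO_integral_sub_sum (continuous_informationGap hp hsum) hc hg hq
      (fun v hv => by rw [abs_of_nonneg (hq0 v hv)]; exact hB v hv) hα (N + 1)
    refine IsBigO.congr' (Complex.isBigO_ofReal_left.2 key) ?_ EventuallyEq.rfl
    filter_upwards [eventually_gt_atTop 0] with s hs
    rw [entropy_sub_avgMutualInfo hx hh hn hindep hnoise hS hs.le, hden,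
      integral_modulus_density (measurable_of_hasSum_pow hq) hq0 hf
        (fun v => informationGap (pmfOf P x) S (s * v)), Complex.ofReal_sub, Complex.ofReal_sum]
    congr 1
    refine Finset.sum_congr rfl fun k _ => ?_
    have hk : (α + k : ℝ) ≠ 0 := by positivity
    rw [hcast, (hmel k).2, ← Complex.ofReal_mul, ← Complex.ofReal_mul]
    congr 1
    field_simp

end Channel

/-! ### The modified Bessel function of order zero -/

section Bessel

lemma summable_pow_div_factorial_sq (y : ℝ) :
    Summable fun k : ℕ => ‖y ^ k / (k.factorial : ℝ) ^ 2‖ := by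
  refine Summable.of_nonneg_of_le (fun _ => norm_nonneg _) (fun k => ?_)
    (Real.summable_pow_div_factorial |y|)
  rw [norm_div, norm_pow, norm_pow, Real.norm_natCast, Real.norm_eq_abs]
  have h : (1 : ℝ) ≤ k.factorial := by exact_mod_cast Nat.one_le_iff_ne_zero.2 k.factorial_ne_zero
  gcongr
  nlinarith

lemma hasSum_besselI0 (z : ℝ) :
    HasSum (fun k : ℕ => (z ^ 2 / 4) ^ k / ((k.factorial : ℝ) ^ 2)) (besselI0 z) :=
  (summable_pow_div_factorial_sq _).of_norm.hasSum

lemma besselI0_zero : besselI0 0 = 1 := by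
  refine (hasSum_besselI0 0).unique ?_
  convert hasSum_ite_eq (0 : ℕ) (1 : ℝ) using 2 with k
  rcases k with _ | k <;> simp

lemma besselI0_nonneg (z : ℝ) : 0 ≤ besselI0 z :=
  tsum_nonneg fun _ => by positivity

/-- The series is ∑ c_k² with c_k = (z/2)^k / k!. Each c_k is at most ∑ c_k = exp(z/2), so the
series is at most exp(z/2)². -/
lemma besselI0_le_exp {z : ℝ} (hz : 0 ≤ z) : besselI0 z ≤ Real.exp z := by
  have h1 : HasSum (fun k : ℕ => (z / 2) ^ k / (k.factorial : ℝ)) (Real.exp (z / 2)) := by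
    rw [Real.exp_eq_exp_ℝ]; exact NormedSpace.expSeries_div_hasSum_exp (z / 2)
  have hn : ∀ k : ℕ, 0 ≤ (z / 2) ^ k / (k.factorial : ℝ) := fun k => by positivity
  have h2 : Real.exp z = Real.exp (z / 2) * Real.exp (z / 2) := by
    rw [← Real.exp_add, add_halves]
  rw [h2]
  refine hasSum_le (fun k => ?_) (hasSum_besselI0 z) (h1.mul_right (Real.exp (z / 2)))
  have h3 := le_hasSum h1 k fun j _ => hn j
  calc (z ^ 2 / 4) ^ k / (k.factorial : ℝ) ^ 2
      = (z / 2) ^ k / (k.factorial : ℝ) * ((z / 2) ^ k / (k.factorial : ℝ)) := by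
        rw [div_mul_div_comm, ← mul_pow, ← sq]; ring_nf
    _ ≤ _ := mul_le_mul_of_nonneg_left h3 (hn k)

lemma prod_wallis_eq (k : ℕ) :
    ∏ i ∈ Finset.range k, ((2 * i + 1 : ℝ) / (2 * i + 2)) =
      (2 * k).factorial / (4 ^ k * (k.factorial : ℝ) ^ 2) := by
  induction k with
  | zero => simp
  | succ k ih =>
    rw [Finset.prod_range_succ, ih, Nat.factorial_succ k, show 2 * (k + 1) = 2 * k + 1 + 1 by ring,
      Nat.factorial_succ, Nat.factorial_succ]
    have := Nat.factorial_ne_zero k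
    push_cast
    field_simp
    ring

/-- Termwise integration of the cosh series: the Wallis integrals of even powers of sine produce the
squared factorials. -/
lemma integral_cosh_mul_sin (z : ℝ) :
    ∫ t in (0 : ℝ)..Real.pi, Real.cosh (z * Real.sin t) = Real.pi * besselI0 z := by
  have h1 := intervalIntegral.hasSum_integral_of_dominated_convergence (μ := volume) (a := 0)
    (b := Real.pi) (F := fun (k : ℕ) t => (z * Real.sin t) ^ (2 * k) / ((2 * k).factorial : ℝ))
    (f := fun t => Real.cosh (z * Real.sin t))
    (fun k _ => z ^ (2 * k) / ((2 * k).factorial : ℝ))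
    (fun k => by fun_prop)
    (fun k => ae_of_all _ fun t _ => by
      rw [mul_pow, norm_div, norm_mul, Real.norm_natCast, norm_pow, norm_pow, pow_mul, pow_mul,
        Real.norm_eq_abs, Real.norm_eq_abs, sq_abs, sq_abs, pow_mul]
      refine div_le_div_of_nonneg_right (mul_le_of_le_one_right (by positivity) ?_) (by positivity)
      exact pow_le_one₀ (sq_nonneg _) (Real.sin_sq_le_one t))
    (ae_of_all _ fun t _ => (Real.hasSum_cosh z).summable)
    (by simp) (ae_of_all _ fun t _ => Real.hasSum_cosh _)
  refine h1.unique (((hasSum_besselI0 z).mul_left Real.pi).congr_fun fun k => ?_)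
  simp only [mul_pow, div_eq_mul_inv, intervalIntegral.integral_mul_const,
    intervalIntegral.integral_const_mul]
  rw [integral_sin_pow_even, prod_wallis_eq]
  have h2 := Nat.factorial_ne_zero (2 * k)
  have h3 := Nat.factorial_ne_zero k
  rw [pow_mul, inv_pow]
  field_simp

/-- Periodicity absorbs the phase, and folding the negative half-period onto the positive one turns
exp into 2 cosh. -/
lemma integral_exp_mul_cos_sub (z t₀ : ℝ) :
    ∫ t in -Real.pi..Real.pi, Real.exp (z * Real.cos (t - t₀)) = 2 * Real.pi * besselI0 z := by
  have hper : Function.Periodic (fun t => Real.exp (z * Real.sin t)) (2 * Real.pi) := fun t => by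
    simp only [Real.sin_add_two_pi]
  have hint : ∀ a b : ℝ, IntervalIntegrable (fun t => Real.exp (z * Real.sin t)) volume a b :=
    fun a b => (by fun_prop : Continuous fun t => Real.exp (z * Real.sin t)).intervalIntegrable a b
  have h1 : ∀ t, Real.exp (z * Real.cos (t - t₀)) =
      Real.exp (z * Real.sin (t + (Real.pi / 2 - t₀))) := fun t => by
    rw [← Real.sin_add_pi_div_two]; ring_nf
  have h2 : ∫ t in -Real.pi..0, Real.exp (z * Real.sin t) =
      ∫ t in 0..Real.pi, Real.exp (-(z * Real.sin t)) := by
    have := intervalIntegral.integral_comp_neg (a := 0) (b := Real.pi)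
      (fun t => Real.exp (z * Real.sin t))
    rw [neg_zero] at this
    rw [← this]
    simp only [Real.sin_neg, mul_neg]
  have h3 := hper.intervalIntegral_add_eq (-Real.pi + (Real.pi / 2 - t₀)) (-Real.pi)
  have e1 : -Real.pi + (Real.pi / 2 - t₀) + 2 * Real.pi = Real.pi + (Real.pi / 2 - t₀) := by ring
  have e2 : -Real.pi + 2 * Real.pi = Real.pi := by ring
  rw [e1, e2] at h3
  simp only [h1]
  rw [intervalIntegral.integral_comp_add_right (fun t => Real.exp (z * Real.sin t)), h3,
    ← intervalIntegral.integral_add_adjacent_intervals (hint (-Real.pi) 0) (hint 0 Real.pi), h2,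
    ← intervalIntegral.integral_add
      ((by fun_prop : Continuous fun t => Real.exp (-(z * Real.sin t))).intervalIntegrable _ _)
      (hint 0 Real.pi), mul_assoc, ← integral_cosh_mul_sin, ← intervalIntegral.integral_const_mul]
  refine intervalIntegral.integral_congr fun t _ => ?_
  simp only [Real.cosh_eq]
  ring

lemma lintegral_exp_mul_cos_sub (z t₀ : ℝ) :
    ∫⁻ t in Set.Ioo (-Real.pi) Real.pi, ENNReal.ofReal (Real.exp (z * Real.cos (t - t₀))) =
      ENNReal.ofReal (2 * Real.pi * besselI0 z) := by
  have hle : -Real.pi ≤ Real.pi := by linarith [Real.pi_pos]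
  have hc : Continuous fun t => Real.exp (z * Real.cos (t - t₀)) := by fun_prop
  rw [← integral_exp_mul_cos_sub z t₀, intervalIntegral.integral_of_le hle,
    ← setIntegral_congr_set Ioo_ae_eq_Ioc, ofReal_integral_eq_lintegral_ofReal
      ((hc.integrableOn_Icc).mono_set Set.Ioo_subset_Icc_self)
      (ae_of_all _ fun t => (Real.exp_pos _).le)]

end Bessel

/-! ### Rayleigh, Rice and Nakagami densities -/

section Densities

variable {Ω : Type*} [MeasurableSpace Ω] {P : Measure Ω} {h : Ω → ℂ}

lemma riceDensity_zero (σ r : ℝ) : riceDensity 0 σ r = rayleighDensity σ r := by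
  simp [riceDensity, rayleighDensity, besselI0_zero]

lemma measurable_besselI0 : Measurable besselI0 :=
  measurable_of_tendsto_metrizable
    (f := fun n (z : ℝ) => ∑ k ∈ Finset.range n, (z ^ 2 / 4) ^ k / ((k.factorial : ℝ) ^ 2))
    (fun n => by fun_prop) (tendsto_pi_nhds.2 fun z => (hasSum_besselI0 z).tendsto_sum_nat)

/-- The modulus of a complex Gaussian variable follows the Rice law. -/
theorem modulusHasDensity_of_complexGaussian (hh : Measurable h) {ν : ℂ} {σ : ℝ} (hσ : 0 < σ)
    (hlaw : P.map h = complexGaussian ν (Real.toNNReal (2 * σ ^ 2))) :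
    ModulusHasDensity P h (riceDensity ‖ν‖ σ) := by
  have hv : Real.toNNReal (2 * σ ^ 2) ≠ 0 := by
    rw [Ne, Real.toNNReal_eq_zero, not_le]; positivity
  have hvc : ((Real.toNNReal (2 * σ ^ 2) : NNReal) : ℝ) = 2 * σ ^ 2 :=
    Real.coe_toNNReal _ (by positivity)
  have hrm : Measurable fun r => ENNReal.ofReal (riceDensity ‖ν‖ σ r) := by
    have := measurable_besselI0
    unfold riceDensity
    fun_prop
  unfold ModulusHasDensity
  refine Measure.ext_of_lintegral _ fun F hF => ?_
  have hmap : ∫⁻ r, F r ∂(P.map fun ω => ‖h ω‖) = ∫⁻ z, F ‖z‖ ∂(P.map h) := by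
    rw [lintegral_map hF hh.norm, lintegral_map (f := fun z => F ‖z‖) (hF.comp measurable_norm) hh]
  rw [hmap, hlaw, complexGaussian_eq_withDensity ν hv, hvc,
    lintegral_withDensity_eq_lintegral_mul _ (by fun_prop) (g := fun z => F ‖z‖)
      (hF.comp measurable_norm), ← Complex.lintegral_comp_polarCoord_symm,
    lintegral_withDensity_eq_lintegral_mul _ hrm hF]
  rw [polarCoord_target, Measure.volume_eq_prod, ← Measure.prod_restrict, lintegral_prod]
  · refine setLIntegral_congr_fun measurableSet_Ioi fun r hr => ?_
    have hr0 : 0 < r := hr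
    have hpt : ∀ θ : ℝ, ENNReal.ofReal r * (ENNReal.ofReal
        (Real.exp (-(‖Complex.polarCoord.symm (r, θ) - ν‖ ^ 2 / (2 * σ ^ 2))) /
          (Real.pi * (2 * σ ^ 2))) * F ‖Complex.polarCoord.symm (r, θ)‖) =
        ENNReal.ofReal (r / σ ^ 2 * Real.exp (-((r ^ 2 + ‖ν‖ ^ 2) / (2 * σ ^ 2))) /
          (2 * Real.pi)) * F r *
          ENNReal.ofReal (Real.exp (r * ‖ν‖ / σ ^ 2 * Real.cos (θ - ν.arg))) := by
      intro θ
      have hn : ‖Complex.polarCoord.symm (r, θ)‖ = r := by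
        rw [Complex.norm_polarCoord_symm, abs_of_pos hr0]
      -- The law of cosines isolates the dependence on the angle, whose integral is the Bessel
      -- function.
      have hd : ‖Complex.polarCoord.symm (r, θ) - ν‖ ^ 2 =
          r ^ 2 + ‖ν‖ ^ 2 - 2 * (r * ‖ν‖ * Real.cos (θ - ν.arg)) := by
        have h1 := Complex.norm_mul_cos_arg ν
        have h2 := Complex.norm_mul_sin_arg ν
        have h3 : ‖ν‖ ^ 2 = ν.re ^ 2 + ν.im ^ 2 := by
          rw [← Complex.normSq_eq_norm_sq, Complex.normSq_apply]; ring
        rw [← Complex.normSq_eq_norm_sq, Complex.normSq_apply, h3, Complex.polarCoord_symm_apply,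
          Real.cos_sub]
        simp only [Complex.sub_re, Complex.sub_im, Complex.mul_re, Complex.mul_im, Complex.add_re,
          Complex.add_im, Complex.ofReal_re, Complex.ofReal_im, Complex.I_re, Complex.I_im]
        linear_combination r ^ 2 * Real.sin_sq_add_cos_sq θ + 2 * r * Real.cos θ * h1 +
          2 * r * Real.sin θ * h2
      rw [hn, hd, ← mul_assoc, ← ENNReal.ofReal_mul hr0.le,
        mul_right_comm (ENNReal.ofReal _) (F r), ← ENNReal.ofReal_mul (by positivity)]
      congr 2
      rw [div_mul_eq_mul_div, mul_assoc (r / σ ^ 2), ← Real.exp_add]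
      have : -((r ^ 2 + ‖ν‖ ^ 2 - 2 * (r * ‖ν‖ * Real.cos (θ - ν.arg))) / (2 * σ ^ 2)) =
          -((r ^ 2 + ‖ν‖ ^ 2) / (2 * σ ^ 2)) + r * ‖ν‖ / σ ^ 2 * Real.cos (θ - ν.arg) := by
        field_simp; ring
      rw [this]
      field_simp
    simp only [Pi.mul_apply, smul_eq_mul, hpt]
    rw [lintegral_const_mul _ (by fun_prop), lintegral_exp_mul_cos_sub, mul_right_comm,
      ← ENNReal.ofReal_mul (by positivity)]
    congr 2
    unfold riceDensity
    have := Real.pi_ne_zero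
    field_simp
  · have hpm : Measurable fun p : ℝ × ℝ => Complex.polarCoord.symm p := by
      simp only [Complex.polarCoord_symm_apply]; fun_prop
    have hF' : Measurable fun z : ℂ => F ‖z‖ := hF.comp measurable_norm
    have hD : Measurable fun z : ℂ => ENNReal.ofReal
        (Real.exp (-(‖z - ν‖ ^ 2 / (2 * σ ^ 2))) / (Real.pi * (2 * σ ^ 2))) := by fun_prop
    exact (measurable_fst.ennreal_ofReal.smul ((hD.mul hF').comp hpm)).aemeasurable

/-- The coefficients of the power series of the Rice density as a function of the squared
modulus. -/
def riceSeriesCoeff (ρ σ : ℝ) (k : ℕ) : ℝ :=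
  Real.exp (-(ρ ^ 2 / (2 * σ ^ 2))) * ∑ j ∈ Finset.range (k + 1),
    (-1 : ℝ) ^ (k - j) / (((k - j).factorial : ℝ) * (2 * σ ^ 2) ^ (k + j + 1)) *
      (ρ ^ (2 * j) / (j.factorial : ℝ) ^ 2)

/-- The Rice density divided by `2 r`, as a function of the squared modulus `v = r ^ 2`. -/
def riceProfile (ρ σ v : ℝ) : ℝ :=
  Real.exp (-(ρ ^ 2 / (2 * σ ^ 2))) / (2 * σ ^ 2) *
    ((∑' k : ℕ, (v * (ρ ^ 2 / (4 * σ ^ 4))) ^ k / (k.factorial : ℝ) ^ 2) *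
      Real.exp (-(v / (2 * σ ^ 2))))

lemma riceProfile_eq {ρ σ v : ℝ} (hv : 0 ≤ v) :
    riceProfile ρ σ v = Real.exp (-(ρ ^ 2 / (2 * σ ^ 2))) / (2 * σ ^ 2) *
      (besselI0 (√v * ρ / σ ^ 2) * Real.exp (-(v / (2 * σ ^ 2)))) := by
  have h : (√v * ρ / σ ^ 2) ^ 2 / 4 = v * (ρ ^ 2 / (4 * σ ^ 4)) := by
    rw [div_pow, mul_pow, Real.sq_sqrt hv]; ring
  rw [riceProfile, besselI0, h]

/-- The coefficients are the Cauchy product of the Bessel series in v with the series of exp(-v /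
(2σ²)). -/
lemma hasSum_riceProfile {σ : ℝ} (hσ : 0 < σ) (ρ v : ℝ) :
    HasSum (fun k => riceSeriesCoeff ρ σ k * v ^ k) (riceProfile ρ σ v) := by
  have hf := summable_pow_div_factorial_sq (v * (ρ ^ 2 / (4 * σ ^ 4)))
  have hg : Summable fun k : ℕ => ‖(-(v / (2 * σ ^ 2))) ^ k / (k.factorial : ℝ)‖ :=
    (Real.summable_pow_div_factorial (-(v / (2 * σ ^ 2)))).norm
  have hexp : Real.exp (-(v / (2 * σ ^ 2))) =
      ∑' k : ℕ, (-(v / (2 * σ ^ 2))) ^ k / (k.factorial : ℝ) := by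
    rw [Real.exp_eq_exp_ℝ, (NormedSpace.expSeries_div_hasSum_exp (-(v / (2 * σ ^ 2)))).tsum_eq]
  rw [riceProfile, hexp, tsum_mul_tsum_eq_tsum_sum_range_of_summable_norm hf hg]
  have hs := (summable_norm_sum_mul_range_of_summable_norm hf hg).of_norm.hasSum
  refine (hs.mul_left _).congr_fun fun k => ?_
  rw [riceSeriesCoeff, div_eq_mul_inv (Real.exp _), mul_assoc (Real.exp _) (Finset.sum _ _),
    mul_assoc (Real.exp _) (2 * σ ^ 2)⁻¹]
  congr 1
  rw [Finset.sum_mul, Finset.mul_sum]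
  refine Finset.sum_congr rfl fun j hj => ?_
  have hjk : j ≤ k := Nat.lt_succ_iff.1 (Finset.mem_range.1 hj)
  obtain ⟨i, rfl⟩ := Nat.exists_eq_add_of_le hjk
  have h1 := Nat.factorial_ne_zero j
  have h2 := Nat.factorial_ne_zero i
  have h3 : 2 * σ ^ 2 ≠ 0 := by positivity
  have h4 : 4 * σ ^ 4 = (2 * σ ^ 2) ^ 2 := by ring
  rw [Nat.add_sub_cancel_left, neg_eq_neg_one_mul (v / _), h4]
  -- With β = 2σ², the exponent k + j + 1 is made up of 2j from the Bessel factor, k - j from the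
  -- exponential and 1 from the prefactor.
  generalize 2 * σ ^ 2 = β at h3 ⊢
  simp only [mul_pow, div_pow]
  field_simp
  ring

lemma riceProfile_nonneg {ρ σ v : ℝ} (hv : 0 ≤ v) : 0 ≤ riceProfile ρ σ v := by
  rw [riceProfile_eq hv]
  have := besselI0_nonneg (√v * ρ / σ ^ 2)
  positivity

/-- The bound I₀(z) ≤ exp z completes a square: the total exponent becomes -(√v - ρ)² / (2σ²) ≤ 0.
-/
lemma riceProfile_le {ρ σ v : ℝ} (hσ : 0 < σ) (hρ : 0 ≤ ρ) (hv : 0 ≤ v) :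
    riceProfile ρ σ v ≤ 1 / (2 * σ ^ 2) := by
  rw [riceProfile_eq hv]
  have h1 : besselI0 (√v * ρ / σ ^ 2) ≤ Real.exp (√v * ρ / σ ^ 2) :=
    besselI0_le_exp (by positivity)
  have h2 : Real.exp (-(ρ ^ 2 / (2 * σ ^ 2))) * (Real.exp (√v * ρ / σ ^ 2) *
      Real.exp (-(v / (2 * σ ^ 2)))) ≤ 1 := by
    rw [← Real.exp_add, ← Real.exp_add, Real.exp_le_one_iff]
    have : -(ρ ^ 2 / (2 * σ ^ 2)) + (√v * ρ / σ ^ 2 + -(v / (2 * σ ^ 2))) =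
        -((√v - ρ) ^ 2 / (2 * σ ^ 2)) := by
      rw [sub_sq, Real.sq_sqrt hv]; field_simp; ring
    rw [this, neg_nonpos]; positivity
  rw [div_mul_eq_mul_div]
  refine div_le_div_of_nonneg_right (le_trans ?_ h2) (by positivity)
  gcongr

lemma riceDensity_eq_profile {ρ σ r : ℝ} (hr : 0 < r) :
    riceDensity ρ σ r = 2 * r ^ (2 * (1 : ℝ) - 1) * riceProfile ρ σ (r ^ 2) := by
  rw [riceProfile_eq (sq_nonneg r), Real.sqrt_sq hr.le, riceDensity, add_div, neg_add, Real.exp_add,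
    show 2 * (1 : ℝ) - 1 = 1 by norm_num, Real.rpow_one]
  ring

lemma modulusHasDensity_of_isRayleighOrRiceFading (hh : Measurable h) {ν : ℂ} {σ : ℝ} (hσ : 0 < σ)
    (hfad : IsRayleighOrRiceFading P h ν σ) : ModulusHasDensity P h (riceDensity ‖ν‖ σ) := by
  rcases hfad with hlaw | ⟨rfl, hden⟩ | ⟨-, hden⟩
  · exact modulusHasDensity_of_complexGaussian hh hσ hlaw
  · rw [norm_zero, show riceDensity 0 σ = rayleighDensity σ from funext (riceDensity_zero σ)]
    exact hden
  · exact hden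

lemma nakagami_coeff_div (μ w : ℝ) (k : ℕ) :
    μ ^ μ / (Real.Gamma μ * w ^ μ) * ((-1 : ℝ) ^ k * μ ^ k / (k.factorial * w ^ k)) / (μ + k) =
      μ ^ μ / (Real.Gamma μ * w ^ μ) *
        ((-1 : ℝ) ^ k * μ ^ k / ((μ + k) * (k.factorial : ℝ) * w ^ k)) := by
  rw [mul_div_assoc, div_div]
  ring_nf

lemma hasSum_exp_neg_mul (A b v : ℝ) :
    HasSum (fun k : ℕ => A * ((-b) ^ k / (k.factorial : ℝ)) * v ^ k)
      (A * Real.exp (-(b * v))) := by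
  have h : HasSum (fun k : ℕ => (-(b * v)) ^ k / (k.factorial : ℝ)) (Real.exp (-(b * v))) := by
    rw [Real.exp_eq_exp_ℝ]; exact NormedSpace.expSeries_div_hasSum_exp (-(b * v))
  refine (h.mul_left A).congr_fun fun k => ?_
  rw [← neg_mul, mul_pow]; ring

end Densities

lemma riceCoeff_eq_riceSeriesCoeff_div (M : ℂ → ℂ) (ν : ℂ) (σ : ℝ) (k : ℕ) :
    riceCoeff M ν σ k = ((riceSeriesCoeff ‖ν‖ σ k / (1 + k) : ℝ) : ℂ) * M (2 + k) := by
  rw [riceCoeff, riceSeriesCoeff]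
  congr 2
  rw [mul_div_assoc, Finset.sum_div]
  congr 1
  refine Finset.sum_congr rfl fun j _ => ?_
  have hk : (1 + k : ℝ) ≠ 0 := by positivity
  rw [mul_assoc ((k : ℝ) + 1), add_comm (k : ℝ) 1, ← div_div, div_right_comm, div_mul_eq_mul_div]

lemma entropy_of_isEquiprobable {Ω : Type*} [MeasurableSpace Ω] {P : Measure Ω} {x : Ω → ℂ}
    {S : Finset ℂ} (hne : S.Nonempty) (he : IsEquiprobable P x S) :
    entropy P x S = Real.log S.card := by
  have hc : (S.card : ℝ) ≠ 0 := by exact_mod_cast hne.card_pos.ne'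
  unfold entropy
  rw [Finset.sum_congr rfl fun a ha => by rw [he a ha], Finset.sum_const, nsmul_eq_mul, one_div,
    Real.log_inv]
  field_simp

lemma nakagamiDensity_eq {μ w r : ℝ} :
    nakagamiDensity μ w r = 2 * r ^ (2 * μ - 1) *
      (μ ^ μ / (Real.Gamma μ * w ^ μ) * Real.exp (-(μ / w * r ^ 2))) := by
  rw [nakagamiDensity]; ring

end
end FadingChannel

theorem mainTheorem4 {Ω : Type*} [MeasurableSpace Ω] (P : Measure Ω) [IsProbabilityMeasure P]
    (x h n : Ω → ℂ) (hx : Measurable x) (hh : Measurable h) (hn : Measurable n)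
    (hindep : iIndepFun ![x, h, n] P)
    (hnoise : P.map n = FadingChannel.complexGaussian 0 1)
    (S : Finset ℂ) (hS : FadingChannel.HasFiniteSupport P x S) :
    (∀ (ν : ℂ) (σ : ℝ), 0 < σ → FadingChannel.IsRayleighOrRiceFading P h ν σ →
      (∀ k : ℕ, MellinConvergent (FadingChannel.mmseC P x n) (2 + k)) ∧
      FadingChannel.HasAsymptoticExpansion
        (fun snr => ((FadingChannel.entropy P x S
          - FadingChannel.avgMutualInfo P x h n snr : ℝ) : ℂ))
        (FadingChannel.riceCoeff (mellin (FadingChannel.mmseC P x n)) ν σ)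
        (fun k snr => snr ^ (-(1 + k : ℝ))) ∧
      (FadingChannel.IsEquiprobable P x S →
        FadingChannel.HasAsymptoticExpansion
          (fun snr => ((Real.log S.card
            - FadingChannel.avgMutualInfo P x h n snr : ℝ) : ℂ))
          (FadingChannel.riceCoeff (mellin (FadingChannel.mmseC P x n)) ν σ)
          (fun k snr => snr ^ (-(1 + k : ℝ))))) ∧
    (∀ μ w : ℝ, 1 / 2 ≤ μ → 0 < w →
      FadingChannel.ModulusHasDensity P h (FadingChannel.nakagamiDensity μ w) →
      (∀ k : ℕ, MellinConvergent (FadingChannel.mmseC P x n) (1 + μ + k)) ∧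
      FadingChannel.HasAsymptoticExpansion
        (fun snr => ((FadingChannel.entropy P x S
          - FadingChannel.avgMutualInfo P x h n snr : ℝ) : ℂ))
        (FadingChannel.nakagamiCoeff (mellin (FadingChannel.mmseC P x n)) μ w)
        (fun k snr => snr ^ (-(μ + k : ℝ))) ∧
      (FadingChannel.IsEquiprobable P x S →
        FadingChannel.HasAsymptoticExpansion
          (fun snr => ((Real.log S.card
            - FadingChannel.avgMutualInfo P x h n snr : ℝ) : ℂ))
          (FadingChannel.nakagamiCoeff (mellin (FadingChannel.mmseC P x n)) μ w)
          (fun k snr => snr ^ (-(μ + k : ℝ))))) := by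
  have hne := FadingChannel.support_nonempty hS
  refine ⟨fun ν σ hσ hfad => ?_, fun μ w hμ hw hden => ?_⟩
  -- Here `one_pos` fixes α = 1, so the Mellin argument 1 + α + k becomes 2 + k.
  · obtain ⟨h1, h2⟩ := FadingChannel.hasAsymptoticExpansion_of_modulusHasDensity hx hh hn hindep
      hnoise hS (FadingChannel.modulusHasDensity_of_isRayleighOrRiceFading hh hσ hfad) one_pos
      (FadingChannel.hasSum_riceProfile hσ ‖ν‖)
      (fun v hv => FadingChannel.riceProfile_nonneg hv.le)
      (fun v hv => FadingChannel.riceProfile_le hσ (norm_nonneg ν) hv.le)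
      (fun r hr => FadingChannel.riceDensity_eq_profile hr)
    have hs : ∀ k : ℕ, (1 + ((1 : ℝ) : ℂ) + k) = 2 + k := fun k => by push_cast; ring
    simp only [hs, ← FadingChannel.riceCoeff_eq_riceSeriesCoeff_div] at h1 h2
    exact ⟨h1, h2, fun he => FadingChannel.entropy_of_isEquiprobable hne he ▸ h2⟩
  · have hμ0 : 0 < μ := by linarith
    have hA : 0 ≤ μ ^ μ / (Real.Gamma μ * w ^ μ) := by
      have := Real.Gamma_pos_of_pos hμ0
      positivity
    -- Here α = μ and q(v) is a constant times exp(-(μ/w) v), so that constant bounds q.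
    obtain ⟨h1, h2⟩ := FadingChannel.hasAsymptoticExpansion_of_modulusHasDensity hx hh hn hindep
      hnoise hS hden hμ0 (FadingChannel.hasSum_exp_neg_mul (μ ^ μ / (Real.Gamma μ * w ^ μ)) (μ / w))
      (fun v _ => mul_nonneg hA (Real.exp_pos _).le)
      (fun v hv => mul_le_of_le_one_right hA (Real.exp_le_one_iff.2
        (neg_nonpos.2 (mul_nonneg (div_pos hμ0 hw).le hv.le))))
      (fun r _ => FadingChannel.nakagamiDensity_eq)
    have hc : (fun k : ℕ => ((μ ^ μ / (Real.Gamma μ * w ^ μ) *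
        ((-(μ / w)) ^ k / (k.factorial : ℝ)) / (μ + k) : ℝ) : ℂ) *
          mellin (FadingChannel.mmseC P x n) (1 + μ + k)) =
        FadingChannel.nakagamiCoeff (mellin (FadingChannel.mmseC P x n)) μ w := by
      ext k
      rw [FadingChannel.nakagamiCoeff, ← FadingChannel.nakagami_coeff_div]
      congr 4
      rw [neg_eq_neg_one_mul, mul_pow, div_pow, ← mul_div_assoc, div_div, mul_comm (w ^ k)]
    rw [hc] at h2
    exact ⟨h1, h2, fun he => FadingChannel.entropy_of_isEquiprobable hne he ▸ h2⟩
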